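/- Let $M$ be a finite-dimensional smooth manifold (Hausdorff, without boundary), let $\nabla$ be a smooth symmetric (torsion-free) linear connection on $M$, and let $\hbar\neq 0$ be a real number. Let $C^\infty(M)$ be the algebra of complex-valued smooth functions on $M$ and, for $x\in M$, let $\mathfrak m_x\subset C^\infty(M)$ be the ideal of functions vanishing at $x$. A differential operator of order (at most) $r$ is a $\mathbb C$-linear map $P\colon C^\infty(M)\to C^\infty(M)$ with $P(\mathfrak m_x^{r+1})\subseteq\mathfrak m_x$ for every $x\in M$; a linear differential operator is one of some order $r\in\mathbb N$. All tensor fields below are smooth with complex values. The symbol of order $r$ of an operator $P$ of order $r$ is the symmetric contravariant tensor field $\sigma^r(P)$ of order $r$ such that $(Pf)(x)=\langle\sigma^r(P)_x,d^r_xf\rangle$ for all $x\in M$ and $f\in\mathfrak m_x^r$, where $\langle\ ,\ \rangle$ is tensor contraction and $d_x^rf$ is the $r$-th differential of $f$ at $x$, computed in any local coordinates around $x$; such a tensor field exists and is unique. For a symmetric contravariant tensor field $\Phi$ of order $r$ and $f\in C^\infty(M)$ put $$\widehat\Phi(f):=(-i\hbar)^r\langle\Phi,\nabla^r_{\mathrm{sym}}f\rangle,$$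 where $\nabla^r_{\mathrm{sym}}f$ is the symmetrization $\frac1{r!}\sum_\pi$ of the $r$-th iterated covariant differential of $f$. For a not necessarily homogeneous symmetric contravariant tensor field, that is, a finite sum $\Phi=\sum_j\Phi_j$ with $\Phi_j$ homogeneous of order $j$, put $\widehat\Phi:=\sum_j\widehat\Phi_j$. Then $\Phi\mapsto\widehat\Phi$ is a ($\mathbb C$-linear) bijection from the not necessarily homogeneous symmetric contravariant tensor fields on $M$ onto the linear differential operators on $C^\infty(M)$. If $P$ is an operator of order $r$ and $\Phi$ is the tensor field with $\widehat\Phi=P$, then $\Phi=\Phi_r+\Phi_{r-1}+\dots+\Phi_0$ (so $\Phi_j=0$ for $j>r$), $$\sigma^r(P)=(-i\hbar)^r\Phi_r,$$ for $k=1,\dots,r$ the operator $P-\widehat\Phi_r-\dots-\widehat\Phi_{r-k+1}$ is of order $r-k$ and $$\sigma^{r-k}\bigl(P-\widehat\Phi_r-\dots-\widehat\Phi_{r-k+1}\bigr)=(-i\hbar)^{r-k}\Phi_{r-k},$$ and $$P=\widehat\Phi=\widehat\Phi_r+\widehat\Phi_{r-1}+\dots+\widehat\Phi_0 .$$ -/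

import Mathlib

open scoped Manifold ContDiff DirectSum

noncomputable section

namespace Quantization

variable {E : Type*} [NormedAddCommGroup E] [NormedSpace ℝ E]
  {M : Type*} [TopologicalSpace M] [ChartedSpace E M]

/-! ### Smooth functions and differential operators -/

variable (E M) in
/-- The `ℂ`-algebra `C^∞(M)` of complex valued smooth functions on `M`. -/
def SmoothFun : Subalgebra ℂ (M → ℂ) where
  carrier := {f | ContMDiff 𝓘(ℝ, E) 𝓘(ℝ, ℂ) ∞ f}
  mul_mem' hf hg := contDiff_mul.contMDiff.comp (hf.prodMk_space hg)
  add_mem' hf hg := hf.add hg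
  algebraMap_mem' _ := contMDiff_const

variable (E) in
/-- The ideal `𝔪_x` of the smooth functions that vanish at `x`. -/
def idealAt (x : M) : Ideal (SmoothFun E M) :=
  RingHom.ker ((Pi.evalRingHom (fun _ : M ↦ ℂ) x).comp (SmoothFun E M).val.toRingHom)

/-- `P` is a differential operator of order (at most) `r`: it maps `𝔪_x ^ (r + 1)` into `𝔪_x`
for each point `x`. -/
def HasOrder (r : ℕ) (P : SmoothFun E M →ₗ[ℂ] SmoothFun E M) : Prop :=
  ∀ x : M, ∀ f ∈ idealAt E x ^ (r + 1), P f ∈ idealAt E x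

theorem HasOrder.mono {r s : ℕ} (h : r ≤ s) {P : SmoothFun E M →ₗ[ℂ] SmoothFun E M}
    (hP : HasOrder r P) : HasOrder s P :=
  fun x f hf ↦ hP x f (Ideal.pow_le_pow_right (Nat.succ_le_succ h) hf)

variable (E M) in
/-- The linear differential operators on `C^∞(M)`, of any finite order. -/
def DiffOp : Submodule ℂ (SmoothFun E M →ₗ[ℂ] SmoothFun E M) where
  carrier := {P | ∃ r, HasOrder r P}
  zero_mem' := ⟨0, fun x _ _ ↦ (idealAt E x).zero_mem⟩
  add_mem' := by
    rintro P Q ⟨r, hP⟩ ⟨s, hQ⟩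
    exact ⟨max r s, fun x f hf ↦ (idealAt E x).add_mem
      (hP.mono (le_max_left r s) x f hf) (hQ.mono (le_max_right r s) x f hf)⟩
  smul_mem' := by
    rintro c P ⟨r, hP⟩
    refine ⟨r, fun x f hf ↦ ?_⟩
    rw [LinearMap.smul_apply, Algebra.smul_def]
    exact (idealAt E x).mul_mem_left _ (hP x f hf)

/-! ### Symmetric contravariant tensor fields -/

variable (E) in
/-- Complex contravariant tensors of order `r` at `x`: the `ℝ`-multilinear maps
`T_x^*M × ⋯ × T_x^*M → ℂ`. -/
abbrev ContraTensor (r : ℕ) (x : M) : Type _ :=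
  MultilinearMap ℝ (fun _ : Fin r ↦ Module.Dual ℝ (TangentSpace 𝓘(ℝ, E) x)) ℂ

variable (E M) in
/-- The smooth symmetric contravariant tensor fields of order `r` on `M` with complex values. The
components in a chart `e` are the values on the covectors `ℓ ∘ d_x e`, with `ℓ` in the dual of
the model space; they have to be smooth on the domain of `e`, for every chart `e`. -/
def SymTensorField (r : ℕ) : Submodule ℂ ((x : M) → ContraTensor E r x) where
  carrier := {Φ |
    (∀ (x : M) (π : Equiv.Perm (Fin r)) (ξ : Fin r → Module.Dual ℝ (TangentSpace 𝓘(ℝ, E) x)),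
      Φ x (fun k ↦ ξ (π k)) = Φ x ξ) ∧
    ∀ e ∈ IsManifold.maximalAtlas 𝓘(ℝ, E) ∞ M, ∀ ℓ : Fin r → Module.Dual ℝ E,
      ContMDiffOn 𝓘(ℝ, E) 𝓘(ℝ, ℂ) ∞
        (fun x ↦ Φ x fun k ↦ (ℓ k).comp (mvfderiv 𝓘(ℝ, E) e x).toLinearMap) e.source}
  zero_mem' := ⟨fun _ _ _ ↦ rfl, fun _ _ _ ↦ contMDiffOn_const⟩
  add_mem' := by
    rintro Φ Ψ ⟨hΦ, hΦ'⟩ ⟨hΨ, hΨ'⟩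
    refine ⟨fun x π ξ ↦ ?_, fun e he ℓ ↦ (hΦ' e he ℓ).add (hΨ' e he ℓ)⟩
    simp only [Pi.add_apply, _root_.add_apply, hΦ x π ξ, hΨ x π ξ]
  smul_mem' := by
    rintro c Φ ⟨hΦ, hΦ'⟩
    refine ⟨fun x π ξ ↦ ?_, fun e he ℓ ↦ (contDiff_const_smul c).contMDiff.comp_contMDiffOn (hΦ' e he ℓ)⟩
    simp only [Pi.smul_apply, _root_.smul_apply, hΦ x π ξ]

variable (E M) in
/-- The not necessarily homogeneous symmetric contravariant tensor fields: finite sums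
`Φ_r + ⋯ + Φ_0`, with `Φ_j` homogeneous of order `j`. -/
abbrev SymTensors : Type _ := ⨁ r : ℕ, SymTensorField E M r

/-- Covariant objects of order `r` at `x`, as functions of `r` tangent vectors. -/
abbrev CoTensor (E : Type*) [NormedAddCommGroup E] [NormedSpace ℝ E]
    {M : Type*} [TopologicalSpace M] [ChartedSpace E M] (r : ℕ) (x : M) : Type _ :=
  (Fin r → TangentSpace 𝓘(ℝ, E) x) → ℂ

/-- The contraction `⟨Φ, η⟩ = ∑ Φ^{i_1 ⋯ i_r} η_{i_1 ⋯ i_r}`, computed in a basis of the tangent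
space and its dual basis (for multilinear `η` it does not depend on the basis). -/
def contract [FiniteDimensional ℝ E] {r : ℕ} {x : M}
    (Φ : ContraTensor E r x) (η : CoTensor E r x) : ℂ :=
  let b : Module.Basis (Fin (Module.finrank ℝ E)) ℝ (TangentSpace 𝓘(ℝ, E) x) :=
    Module.finBasis ℝ E
  ∑ i : Fin r → Fin (Module.finrank ℝ E), Φ (fun k ↦ b.coord (i k)) * η (fun k ↦ b (i k))

/-! ### Symbols -/

/-- The `r`-th differential at `x` of the function `f`, computed in the chart `e`. -/
def chartDiff (e : OpenPartialHomeomorph M E) (r : ℕ) (f : M → ℂ) (x : M) : CoTensor E r x :=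
  fun v ↦ iteratedFDeriv ℝ r (f ∘ e.symm) (e x) fun k ↦ mvfderiv 𝓘(ℝ, E) e x (v k)

/-- `σ` is the symbol of order `r` of the operator `P` of order `r`:
`(P f)(x) = ⟨σ_x, d_x^r f⟩` for all points `x` and all `f ∈ 𝔪_x ^ r`, where `d_x^r f` is computed
in any local coordinates. -/
def IsSymbol [FiniteDimensional ℝ E] (r : ℕ) (P : SmoothFun E M →ₗ[ℂ] SmoothFun E M)
    (σ : SymTensorField E M r) : Prop :=
  HasOrder r P ∧
    ∀ (x : M), ∀ f ∈ idealAt E x ^ r, ∀ e ∈ IsManifold.maximalAtlas 𝓘(ℝ, E) ∞ M, x ∈ e.source →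
      (P f : M → ℂ) x = contract ((σ : (x : M) → ContraTensor E r x) x) (chartDiff e r f x)

/-! ### Iterated covariant differentials and quantization -/

variable [IsManifold 𝓘(ℝ, E) ∞ M]

/-- The covariant differential of a covariant tensor field `T`:
`(∇T)(v_0, v_1, …, v_r) = v_0 (T(X_1, …, X_r)) - ∑_i T(v_1, …, ∇_{v_0} X_i, …, v_r)`,
where `X_i` is a vector field that extends `v_i` and is smooth near the point. -/
def covDiff (nabla : CovariantDerivative 𝓘(ℝ, E) E (TangentSpace 𝓘(ℝ, E) : M → Type _)) {r : ℕ}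
    (T : (x : M) → CoTensor E r x) (x : M) : CoTensor E (r + 1) x :=
  fun v ↦
    mvfderiv 𝓘(ℝ, E) (fun y ↦ T y fun k ↦ FiberBundle.extend E (v k.succ) y) x (v 0) -
      ∑ k : Fin r, T x (Function.update (fun j ↦ v j.succ) k
        (nabla (FiberBundle.extend E (v k.succ)) x (v 0)))

/-- The iterated covariant differential `∇^r f`. -/
def iterCovDiff (nabla : CovariantDerivative 𝓘(ℝ, E) E (TangentSpace 𝓘(ℝ, E) : M → Type _))
    (f : M → ℂ) : (r : ℕ) → (x : M) → CoTensor E r x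
  | 0 => fun x _ ↦ f x
  | r + 1 => covDiff nabla (iterCovDiff nabla f r)

/-- The symmetrization `η_sym(v_1, …, v_r) = (1 / r!) ∑_π η(v_{π 1}, …, v_{π r})`. -/
def symmetrize {r : ℕ} {x : M} (η : CoTensor E r x) : CoTensor E r x :=
  fun v ↦ (r.factorial : ℂ)⁻¹ * ∑ π : Equiv.Perm (Fin r), η fun k ↦ v (π k)

/-- The quantized of a homogeneous tensor field `Φ` of order `r`, applied to the function `f`:
`(-iħ)^r ⟨Φ, ∇^r_sym f⟩`. -/
def quantized [FiniteDimensional ℝ E]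
    (nabla : CovariantDerivative 𝓘(ℝ, E) E (TangentSpace 𝓘(ℝ, E) : M → Type _)) (hbar : ℝ) {r : ℕ}
    (Φ : SymTensorField E M r) (f : SmoothFun E M) : M → ℂ :=
  fun x ↦ (-Complex.I * hbar) ^ r *
    contract ((Φ : (x : M) → ContraTensor E r x) x) (symmetrize (iterCovDiff nabla f r x))

end Quantization

end

/-! The quantization rule is triangular with respect to the filtration of operators by order, and on
the associated graded level it is multiplication by `(-iħ)^r`, which is invertible as `ħ ≠ 0`. Two
facts carry this.

Symbols: if `P` has order `r`, the value of `P (∏ f_k)` at `x`, for `r` functions `f_k ∈ 𝔪_x`,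
depends only on the differentials of the `f_k` at `x`. A function in `𝔪_x` with zero differential
lies in `𝔪_x ^ 2` (Hadamard's lemma, `mem_idealAt_sq`), so replacing the factors changes the product
by an element of `𝔪_x ^ (r + 1)`. Evaluating `P` on products of functions with prescribed
differentials, and dividing by `r!`, gives the symbol. The factor `r!` arises since the `r`-th
differential of such a product is a sum over all permutations (`chartDiff_prod`). The result is
smooth (`contMDiffAt_symbolAt`) and is the only candidate (`IsSymbol.unique`).

Leading term: in a chart, `∇^r f` is the ordinary `r`-th derivative plus Christoffel terms that
involve only derivatives of lower order. Hence it vanishes at `x` for `f ∈ 𝔪_x ^ (r + 1)` and equals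
`d_x^r f` for `f ∈ 𝔪_x ^ r`. So `Φ̂` has order `r` and symbol `(-iħ)^r Φ` when `Φ` is homogeneous of
order `r` (`isSymbol_quantizedHom`).

An operator of order `r + 1` with zero symbol has order `r`, and one of order `0` with zero symbol
is zero. Subtracting from `P` the quantized operator of its rescaled symbol therefore lowers the
order, and repetition gives surjectivity. Comparing symbols in the top degree gives injectivity, the
bound on the degree of `Φ`, and the recursive formulas. -/

noncomputable section

namespace Quantization

section

/-! ### Products in powers of an ideal -/

/-- Changing the factors of a product of `n` elements of an ideal `I` by elements of `I ^ 2` changes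
the product by an element of `I ^ (n + 1)`. -/
theorem prod_sub_prod_mem_pow {A ι : Type*} [CommRing A] (I : Ideal A) (s : Finset ι) (f g : ι → A)
    (hf : ∀ k ∈ s, f k ∈ I) (hfg : ∀ k ∈ s, f k - g k ∈ I ^ 2) :
    ∏ k ∈ s, f k - ∏ k ∈ s, g k ∈ I ^ (s.card + 1) := by
  classical
  induction s using Finset.induction_on with
  | empty => simp
  | insert a s ha ih =>
    have hg : ∀ k ∈ insert a s, g k ∈ I := fun k hk ↦ by
      simpa using I.sub_mem (hf k hk) (Ideal.pow_le_self two_ne_zero (hfg k hk))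
    rw [Finset.prod_insert ha, Finset.prod_insert ha, Finset.card_insert_of_notMem ha]
    have key : f a * ∏ k ∈ s, f k - g a * ∏ k ∈ s, g k =
        f a * (∏ k ∈ s, f k - ∏ k ∈ s, g k) + (f a - g a) * ∏ k ∈ s, g k := by ring
    rw [key]
    refine Ideal.add_mem _ ?_ ?_
    · rw [pow_succ']
      exact Ideal.mul_mem_mul (hf a (Finset.mem_insert_self a s))
        (ih (fun k hk ↦ hf k (Finset.mem_insert_of_mem hk))
          fun k hk ↦ hfg k (Finset.mem_insert_of_mem hk))
    · rw [show s.card + 1 + 1 = 2 + s.card by ring, pow_add]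
      refine Ideal.mul_mem_mul (hfg a (Finset.mem_insert_self a s)) ?_
      rw [← Finset.prod_const]
      exact Ideal.prod_mem_prod fun k hk ↦ hg k (Finset.mem_insert_of_mem hk)

/-! ### Hadamard's lemma -/

section Hadamard

variable {E G : Type*} [NormedAddCommGroup E] [NormedSpace ℝ E] [NormedAddCommGroup G]
  [NormedSpace ℝ G]

open MeasureTheory in
/-- An integral over `[0, 1]` depends smoothly on a parameter if the integrand does. -/
theorem contDiff_intervalIntegral_param {h : E → ℝ → G} (hh : ContDiff ℝ ∞ (Function.uncurry h)) :
    ContDiff ℝ ∞ fun z ↦ ∫ t in (0 : ℝ)..1, h z t := by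
  -- The integral is the convolution at `0` of the indicator of `(0, 1]` with `s ↦ h z (-s)`. The
  -- cutoff `ρ`, equal to `1` on `[-2, 2]`, does not affect the values on `[-1, 0]` and supplies the
  -- compact support, uniform in `z`, that smoothness of a parametrized convolution requires.
  let ρ : ContDiffBump (0 : ℝ) := ⟨2, 3, by norm_num, by norm_num⟩
  let g : E → ℝ → G := fun z s ↦ ρ s • h z (-s)
  let φ : ℝ → ℝ := Set.indicator (Set.Ioc 0 1) 1
  have hφ : LocallyIntegrable φ volume := by
    refine ((integrable_indicator_iff measurableSet_Ioc).2 ?_).locallyIntegrable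
    exact integrableOn_const (by simp)
  have hg : ContDiff ℝ ∞ (Function.uncurry g) := by
    have h1 : ContDiff ℝ ∞ fun q : E × ℝ ↦ ρ q.2 := ρ.contDiff.comp contDiff_snd
    have h2 : ContDiff ℝ ∞ fun q : E × ℝ ↦ h q.1 (-q.2) :=
      hh.comp (contDiff_fst.prodMk contDiff_snd.neg)
    exact h1.smul h2
  have key := contDiffOn_convolution_right_with_param_comp (n := ⊤) (μ := volume)
    (ContinuousLinearMap.lsmul ℝ ℝ : ℝ →L[ℝ] G →L[ℝ] G) (s := (Set.univ : Set E))
    (v := fun _ ↦ (0 : ℝ)) contDiffOn_const (f := φ) (g := g) (k := Metric.closedBall 0 3)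
    isOpen_univ (isCompact_closedBall _ _) (fun z s _ hs ↦ by
      have : ρ s = 0 := ρ.zero_of_le_dist (by
        have := not_le.1 (fun h ↦ hs (Metric.mem_closedBall.2 h))
        exact this.le)
      simp [g, this]) hφ hg.contDiffOn
  rw [contDiffOn_univ] at key
  convert key using 2 with z
  rw [intervalIntegral.integral_of_le zero_le_one, ← integral_indicator measurableSet_Ioc,
    convolution]
  congr 1
  ext t
  by_cases ht : t ∈ Set.Ioc (0 : ℝ) 1
  · have : ρ (-t) = 1 := ρ.one_of_mem_closedBall (by
      simp only [Metric.mem_closedBall, dist_zero_right, norm_neg, Real.norm_eq_abs]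
      rw [abs_of_pos ht.1]
      exact ht.2.trans (by norm_num [ρ]))
    simp [φ, ht, g, this]
  · simp [φ, ht]

/-- **Hadamard's lemma.** -/
theorem exists_contDiff_sub_eq_apply [CompleteSpace G] {F : E → G} (hF : ContDiff ℝ ∞ F) (p : E) :
    ∃ g : E → E →L[ℝ] G, ContDiff ℝ ∞ g ∧ g p = fderiv ℝ F p ∧ ∀ z, F z = F p + g z (z - p) := by
  -- The derivative averaged over the segment from `p` to `z`; the formula is the fundamental
  -- theorem of calculus along that segment.
  refine ⟨fun z ↦ ∫ t in (0 : ℝ)..1, fderiv ℝ F (p + t • (z - p)), ?_, by simp, fun z ↦ ?_⟩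
  · refine contDiff_intervalIntegral_param (h := fun z t ↦ fderiv ℝ F (p + t • (z - p))) ?_
    have h1 : ContDiff ℝ ∞ (fderiv ℝ F) := hF.fderiv_right (by simp)
    exact h1.comp (contDiff_const.add (contDiff_snd.smul (contDiff_fst.sub contDiff_const)))
  · have hcont : Continuous fun t : ℝ ↦ fderiv ℝ F (p + t • (z - p)) :=
      (hF.continuous_fderiv (by simp)).comp (by fun_prop)
    beta_reduce
    rw [ContinuousLinearMap.intervalIntegral_apply (hcont.intervalIntegrable _ _)]
    have hd : ∀ t ∈ Set.uIcc (0 : ℝ) 1, HasDerivAt (fun t : ℝ ↦ F (p + t • (z - p)))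
        (fderiv ℝ F (p + t • (z - p)) (z - p)) t := fun t _ ↦ by
      have h1 : HasDerivAt (fun t : ℝ ↦ p + t • (z - p)) (z - p) t := by
        simpa using ((hasDerivAt_id t).smul_const (z - p)).const_add p
      exact ((hF.differentiable (by simp)) _).hasFDerivAt.comp_hasDerivAt t h1
    rw [intervalIntegral.integral_eq_sub_of_hasDerivAt hd
      ((hcont.clm_apply continuous_const).intervalIntegrable _ _)]
    simp

end Hadamard

/-! ### Vanishing to finite order -/

section Vanishing

variable {E F G H : Type*} [NormedAddCommGroup E] [NormedSpace ℝ E] [NormedAddCommGroup F]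
  [NormedSpace ℝ F] [NormedAddCommGroup G] [NormedSpace ℝ G] [NormedAddCommGroup H]
  [NormedSpace ℝ H]

/-- `f` is smooth at `p` and its derivatives of order less than `k` vanish there. -/
def VanishesToOrder (k : ℕ) (f : E → G) (p : E) : Prop :=
  ContDiffAt ℝ ∞ f p ∧ ∀ j < k, iteratedFDeriv ℝ j f p = 0

namespace VanishesToOrder

variable {k l : ℕ} {f g : E → G} {p : E}

theorem mono (h : l ≤ k) (hf : VanishesToOrder k f p) : VanishesToOrder l f p :=
  ⟨hf.1, fun j hj ↦ hf.2 j (hj.trans_le h)⟩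

theorem congr (hf : VanishesToOrder k f p) (hfg : f =ᶠ[nhds p] g) : VanishesToOrder k g p :=
  ⟨hf.1.congr_of_eventuallyEq hfg.symm, fun j hj ↦ by
    rw [← (hfg.iteratedFDeriv (𝕜 := ℝ) j).eq_of_nhds, hf.2 j hj]⟩

theorem of_contDiffAt (hf : ContDiffAt ℝ ∞ f p) : VanishesToOrder 0 f p :=
  ⟨hf, fun _ hj ↦ absurd hj (Nat.not_lt_zero _)⟩

theorem of_eq_zero (hf : ContDiffAt ℝ ∞ f p) (h : f p = 0) : VanishesToOrder 1 f p :=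
  ⟨hf, fun j hj ↦ by
    obtain rfl : j = 0 := by omega
    ext v
    simpa using h⟩

theorem eq_zero (hf : VanishesToOrder (k + 1) f p) : f p = 0 := by
  have := congrArg (fun m ↦ m 0) (hf.2 0 (Nat.succ_pos k))
  simpa using this

theorem zero : VanishesToOrder k (0 : E → G) p :=
  ⟨contDiffAt_const, fun j _ ↦ by
    rw [show (0 : E → G) = fun _ ↦ 0 from rfl, iteratedFDeriv_fun_zero]; rfl⟩

theorem add (hf : VanishesToOrder k f p) (hg : VanishesToOrder k g p) :
    VanishesToOrder k (f + g) p :=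
  ⟨hf.1.add hg.1, fun j hj ↦ by
    rw [iteratedFDeriv_add_apply (hf.1.of_le (mod_cast le_top)) (hg.1.of_le (mod_cast le_top)),
      hf.2 j hj, hg.2 j hj, add_zero]⟩

theorem neg (hf : VanishesToOrder k f p) : VanishesToOrder k (-f) p :=
  ⟨hf.1.neg, fun j hj ↦ by rw [iteratedFDeriv_neg_apply, hf.2 j hj, neg_zero]⟩

theorem sub (hf : VanishesToOrder k f p) (hg : VanishesToOrder k g p) :
    VanishesToOrder k (f - g) p := by
  rw [sub_eq_add_neg]
  exact hf.add hg.neg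

/-- The Leibniz bound estimates the `n`-th derivative by terms `‖D^i f‖ ‖D^(n-i) g‖`. For `n < k +
l` either `i < k` or `n - i < l`, so every term is zero. -/
theorem bilinear (B : F →L[ℝ] G →L[ℝ] H) {f : E → F} (hf : VanishesToOrder k f p)
    (hg : VanishesToOrder l g p) : VanishesToOrder (k + l) (fun z ↦ B (f z) (g z)) p := by
  refine ⟨(B.contDiff.contDiffAt.comp p hf.1).clm_apply hg.1, fun n hn ↦ ?_⟩
  have hn' : (n : WithTop ℕ∞) ≤ ∞ := mod_cast le_top
  obtain ⟨u, hu, hfu⟩ := (hf.1.of_le hn').contDiffOn le_rfl (by simp)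
  obtain ⟨v, hv, hgv⟩ := (hg.1.of_le hn').contDiffOn le_rfl (by simp)
  obtain ⟨w, hw, hwo, hpw⟩ := mem_nhds_iff.1 (Filter.inter_mem
    (by simpa using hu : u ∈ nhds p) (by simpa using hv : v ∈ nhds p))
  have key := B.norm_iteratedFDerivWithin_le_of_bilinear (hfu.mono fun z hz ↦ (hw hz).1)
    (hgv.mono fun z hz ↦ (hw hz).2) hwo.uniqueDiffOn hpw le_rfl
  simp only [iteratedFDerivWithin_of_isOpen _ hwo hpw] at key
  rw [← norm_le_zero_iff]
  refine key.trans (le_of_eq ?_)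
  rw [Finset.sum_eq_zero, mul_zero]
  intro i hi
  have hi' := Finset.mem_range.1 hi
  rcases lt_or_ge i k with h | h
  · simp [hf.2 i h]
  · simp [hg.2 (n - i) (by omega)]

theorem clm_comp (A : G →L[ℝ] H) (hf : VanishesToOrder k f p) :
    VanishesToOrder k (fun z ↦ A (f z)) p := by
  refine ⟨A.contDiff.contDiffAt.comp p hf.1, fun j hj ↦ ?_⟩
  have := A.iteratedFDeriv_comp_left hf.1 (i := j) (mod_cast le_top)
  rw [show (fun z ↦ A (f z)) = A ∘ f from rfl, this, hf.2 j hj]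
  ext v
  simp

theorem fderiv (hf : VanishesToOrder (k + 1) f p) : VanishesToOrder k (fderiv ℝ f) p :=
  ⟨hf.1.fderiv_right (by simp), fun j hj ↦ by
    rw [← norm_eq_zero, norm_iteratedFDeriv_fderiv, hf.2 (j + 1) (by omega), norm_zero]⟩

end VanishesToOrder

end Vanishing

end

section

variable {E : Type*} [NormedAddCommGroup E] [NormedSpace ℝ E]
  {M : Type*} [TopologicalSpace M] [ChartedSpace E M]

/-! ### Functions read in charts -/

theorem eventuallyEq_comp_symm_comp {X Y Z : Type*} [TopologicalSpace X] [TopologicalSpace Y]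
    {e : OpenPartialHomeomorph X Y} {x : X} (hx : x ∈ e.source) (g : X → Z) :
    (g ∘ e.symm) ∘ e =ᶠ[nhds x] g := by
  filter_upwards [e.open_source.mem_nhds hx] with y hy
  simp [e.left_inv hy]

section Charts

variable {G : Type*} [NormedAddCommGroup G] [NormedSpace ℝ G]

theorem mvfderiv_congr {f g : M → G} {x : M} (h : f =ᶠ[nhds x] g) :
    mvfderiv 𝓘(ℝ, E) f x = mvfderiv 𝓘(ℝ, E) g x := by
  ext v
  change mfderiv 𝓘(ℝ, E) 𝓘(ℝ, G) f x v = mfderiv 𝓘(ℝ, E) 𝓘(ℝ, G) g x v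
  rw [h.mfderiv_eq]
  rfl

variable {e : OpenPartialHomeomorph M E} {x : M}

theorem mdifferentiableAt_chart (he : e ∈ IsManifold.maximalAtlas 𝓘(ℝ, E) ∞ M)
    (hx : x ∈ e.source) : MDifferentiableAt 𝓘(ℝ, E) 𝓘(ℝ, E) e x :=
  (contMDiffAt_of_mem_maximalAtlas he hx).mdifferentiableAt (by simp)

theorem mvfderiv_comp_chart (he : e ∈ IsManifold.maximalAtlas 𝓘(ℝ, E) ∞ M) (hx : x ∈ e.source)
    {h : E → G} (hh : DifferentiableAt ℝ h (e x)) (v : TangentSpace 𝓘(ℝ, E) x) :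
    mvfderiv 𝓘(ℝ, E) (h ∘ e) x v = fderiv ℝ h (e x) (mvfderiv 𝓘(ℝ, E) e x v) := by
  have := mfderiv_comp_apply x hh.mdifferentiableAt (mdifferentiableAt_chart he hx) v
  rw [mfderiv_eq_fderiv] at this
  exact this

theorem differentiableAt_comp_chart_symm (he : e ∈ IsManifold.maximalAtlas 𝓘(ℝ, E) ∞ M)
    (hx : x ∈ e.source) {g : M → G} (hg : MDifferentiableAt 𝓘(ℝ, E) 𝓘(ℝ, G) g x) :
    DifferentiableAt ℝ (g ∘ e.symm) (e x) := by
  rw [← mdifferentiableAt_iff_differentiableAt]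
  have h1 : MDifferentiableAt 𝓘(ℝ, E) 𝓘(ℝ, E) e.symm (e x) :=
    ((contMDiffOn_symm_of_mem_maximalAtlas he).contMDiffAt
      (e.open_target.mem_nhds (e.map_source hx))).mdifferentiableAt (by simp)
  exact MDifferentiableAt.comp (e x) (by rwa [e.left_inv hx]) h1

theorem mvfderiv_eq_fderiv_chart (he : e ∈ IsManifold.maximalAtlas 𝓘(ℝ, E) ∞ M)
    (hx : x ∈ e.source) {g : M → G} (hg : MDifferentiableAt 𝓘(ℝ, E) 𝓘(ℝ, G) g x)
    (v : TangentSpace 𝓘(ℝ, E) x) :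
    mvfderiv 𝓘(ℝ, E) g x v = fderiv ℝ (g ∘ e.symm) (e x) (mvfderiv 𝓘(ℝ, E) e x v) := by
  rw [← mvfderiv_comp_chart he hx (differentiableAt_comp_chart_symm he hx hg),
    mvfderiv_congr (eventuallyEq_comp_symm_comp hx g)]

theorem contDiffAt_comp_chart_symm (he : e ∈ IsManifold.maximalAtlas 𝓘(ℝ, E) ∞ M)
    (hx : x ∈ e.source) {g : M → G} (hg : ContMDiffAt 𝓘(ℝ, E) 𝓘(ℝ, G) ∞ g x) :
    ContDiffAt ℝ ∞ (g ∘ e.symm) (e x) := by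
  rw [← contMDiffAt_iff_contDiffAt]
  have h1 : ContMDiffAt 𝓘(ℝ, E) 𝓘(ℝ, E) ∞ e.symm (e x) :=
    (contMDiffOn_symm_of_mem_maximalAtlas he).contMDiffAt
      (e.open_target.mem_nhds (e.map_source hx))
  exact ContMDiffAt.comp (e x) (by rwa [e.left_inv hx]) h1

theorem contMDiffAt_comp_chart (he : e ∈ IsManifold.maximalAtlas 𝓘(ℝ, E) ∞ M)
    (hx : x ∈ e.source) {h : E → G} (hh : ContDiffAt ℝ ∞ h (e x)) :
    ContMDiffAt 𝓘(ℝ, E) 𝓘(ℝ, G) ∞ (h ∘ e) x :=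
  hh.contMDiffAt.comp x (contMDiffAt_of_mem_maximalAtlas he hx)

/-- The differential of a chart, as a linear equivalence. -/
def chartEquiv (he : e ∈ IsManifold.maximalAtlas 𝓘(ℝ, E) ∞ M) (hx : x ∈ e.source) :
    TangentSpace 𝓘(ℝ, E) x ≃ₗ[ℝ] E :=
  LinearEquiv.ofBijective (mvfderiv 𝓘(ℝ, E) e x).toLinearMap <| by
    have h : e.MDifferentiable 𝓘(ℝ, E) 𝓘(ℝ, E) :=
      ⟨(contMDiffOn_of_mem_maximalAtlas he).mdifferentiableOn (by simp),
        (contMDiffOn_symm_of_mem_maximalAtlas he).mdifferentiableOn (by simp)⟩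
    exact h.mfderiv_bijective hx

theorem chartEquiv_apply (he : e ∈ IsManifold.maximalAtlas 𝓘(ℝ, E) ∞ M) (hx : x ∈ e.source)
    (v : TangentSpace 𝓘(ℝ, E) x) : chartEquiv he hx v = mvfderiv 𝓘(ℝ, E) e x v := rfl

variable [IsManifold 𝓘(ℝ, E) ∞ M]

/-- The tangent space at `x` is identified with `E` through the preferred chart at `x`. A covector
at `x` can thus be applied directly to the coordinates of that chart, as in `coordFun`. -/
theorem mvfderiv_chartAt_self (x : M) (v : TangentSpace 𝓘(ℝ, E) x) :
    mvfderiv 𝓘(ℝ, E) (chartAt E x) x v = v := by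
  have := mfderiv_extChartAt_self (I := 𝓘(ℝ, E)) (x := x)
  rw [extChartAt_coe] at this
  exact congrArg (fun A ↦ A v) this

variable [FiniteDimensional ℝ E] [T2Space M]

/-- A function that is smooth near `x` has the same germ at `x` as a smooth function. -/
theorem exists_contMDiff_eventuallyEq {g : M → G} {U : Set M} (hU : U ∈ nhds x)
    (hg : ∀ y ∈ U, ContMDiffAt 𝓘(ℝ, E) 𝓘(ℝ, G) ∞ g y) :
    ∃ h : M → G, ContMDiff 𝓘(ℝ, E) 𝓘(ℝ, G) ∞ h ∧ h =ᶠ[nhds x] g := by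
  obtain ⟨χ, -, hχ⟩ := (SmoothBumpFunction.nhds_basis_tsupport (I := 𝓘(ℝ, E)) x).mem_iff.1 hU
  refine ⟨fun y ↦ χ y • g y, contMDiff_of_tsupport fun y hy ↦ ?_, ?_⟩
  · exact χ.contMDiffAt.smul (hg y (hχ (tsupport_smul_subset_left _ _ hy)))
  · filter_upwards [χ.eventuallyEq_one] with y hy
    simp [hy]

end Charts

/-! ### Ideals of functions that vanish at a point -/

theorem mem_idealAt {x : M} {f : SmoothFun E M} : f ∈ idealAt E x ↔ (f : M → ℂ) x = 0 :=
  RingHom.mem_ker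

theorem contMDiff_coe (f : SmoothFun E M) : ContMDiff 𝓘(ℝ, E) 𝓘(ℝ, ℂ) ∞ (f : M → ℂ) := f.2

theorem contMDiffAt_mul {f g : M → ℂ} {x : M} (hf : ContMDiffAt 𝓘(ℝ, E) 𝓘(ℝ, ℂ) ∞ f x)
    (hg : ContMDiffAt 𝓘(ℝ, E) 𝓘(ℝ, ℂ) ∞ g x) :
    ContMDiffAt 𝓘(ℝ, E) 𝓘(ℝ, ℂ) ∞ (fun y ↦ f y * g y) x :=
  contDiff_mul.contMDiff.contMDiffAt.comp x (hf.prodMk_space hg)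

theorem mdifferentiableAt_coe (f : SmoothFun E M) (x : M) :
    MDifferentiableAt 𝓘(ℝ, E) 𝓘(ℝ, ℂ) (f : M → ℂ) x :=
  (contMDiff_coe f).contMDiffAt.mdifferentiableAt (by simp)

theorem mvfderiv_coe_add (f g : SmoothFun E M) (x : M) :
    mvfderiv 𝓘(ℝ, E) ((f + g : SmoothFun E M) : M → ℂ) x =
      mvfderiv 𝓘(ℝ, E) (f : M → ℂ) x + mvfderiv 𝓘(ℝ, E) (g : M → ℂ) x :=
  _root_.mvfderiv_add (mdifferentiableAt_coe f x) (mdifferentiableAt_coe g x)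

theorem mvfderiv_coe_sub (f g : SmoothFun E M) (x : M) :
    mvfderiv 𝓘(ℝ, E) ((f - g : SmoothFun E M) : M → ℂ) x =
      mvfderiv 𝓘(ℝ, E) (f : M → ℂ) x - mvfderiv 𝓘(ℝ, E) (g : M → ℂ) x :=
  _root_.mvfderiv_sub (mdifferentiableAt_coe f x) (mdifferentiableAt_coe g x)

section Ideals

variable [IsManifold 𝓘(ℝ, E) ∞ M] [FiniteDimensional ℝ E] [T2Space M]

theorem exists_smoothFun_eventuallyEq {x : M} {g : M → ℂ} {U : Set M} (hU : U ∈ nhds x)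
    (hg : ∀ y ∈ U, ContMDiffAt 𝓘(ℝ, E) 𝓘(ℝ, ℂ) ∞ g y) :
    ∃ f : SmoothFun E M, (f : M → ℂ) =ᶠ[nhds x] g := by
  obtain ⟨h, hs, heq⟩ := exists_contMDiff_eventuallyEq hU hg
  exact ⟨⟨h, hs⟩, heq⟩

/-- With a bump `χ` at `x` supported where `f = 0`, the function `u = 1 - χ` vanishes at `x` and `f
= f u ^ n` for all `n`. This makes membership in `𝔪_x ^ n` a property of germs. -/
theorem mem_idealAt_pow_of_eventuallyEq_zero {x : M} {f : SmoothFun E M}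
    (hf : (f : M → ℂ) =ᶠ[nhds x] 0) (n : ℕ) : f ∈ idealAt E x ^ n := by
  obtain ⟨χ, -, hχ⟩ := (SmoothBumpFunction.nhds_basis_tsupport (I := 𝓘(ℝ, E)) x).mem_iff.1 hf
  have hs : ContMDiff 𝓘(ℝ, E) 𝓘(ℝ, ℂ) ∞ fun y ↦ (1 - χ y : ℂ) :=
    contMDiff_const.sub (Complex.ofRealCLM.contDiff.contMDiff.comp χ.contMDiff)
  let u : SmoothFun E M := ⟨fun y ↦ (1 - χ y : ℂ), hs⟩
  have hu : u ∈ idealAt E x := mem_idealAt.2 (by simp [u])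
  have hfu : f * u = f := by
    ext y
    change (f : M → ℂ) y * (1 - χ y : ℂ) = (f : M → ℂ) y
    by_cases hy : y ∈ tsupport χ
    · have : (f : M → ℂ) y = 0 := hχ hy
      simp [this]
    · simp [image_eq_zero_of_notMem_tsupport hy]
  have hfun : ∀ n : ℕ, f * u ^ n = f := fun n ↦ by
    induction n with
    | zero => simp
    | succ n ih => rw [pow_succ, ← mul_assoc, ih, hfu]
  rw [← hfun n]
  exact Ideal.mul_mem_left _ _ (Ideal.pow_mem_pow hu n)

/-- A smooth function that vanishes at `x` together with its differential is in `𝔪_x ^ 2`. -/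
theorem mem_idealAt_sq {x : M} {f : SmoothFun E M} (hf : (f : M → ℂ) x = 0)
    (hdf : ∀ v, mvfderiv 𝓘(ℝ, E) (f : M → ℂ) x v = 0) : f ∈ idealAt E x ^ 2 := by
  let e := chartAt E x
  have he : e ∈ IsManifold.maximalAtlas 𝓘(ℝ, E) ∞ M := IsManifold.chart_mem_maximalAtlas x
  have hx : x ∈ e.source := mem_chart_source E x
  -- Hadamard's lemma is applied on all of `E`, so the chart expression is first replaced by a
  -- globally smooth function with the same germ.
  obtain ⟨F, hFs, hF⟩ := exists_contMDiff_eventuallyEq (E := E) (x := e x)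
    (g := (f : M → ℂ) ∘ e.symm) (U := e.target) (e.open_target.mem_nhds (e.map_source hx))
    fun y hy ↦ by
      have := contDiffAt_comp_chart_symm he (e.map_target hy) (contMDiff_coe f).contMDiffAt
      rw [e.right_inv hy] at this
      exact this.contMDiffAt
  rw [contMDiff_iff_contDiff] at hFs
  have hFp : F (e x) = 0 := by rw [hF.eq_of_nhds]; simp [e.left_inv hx, hf]
  have hdF : fderiv ℝ F (e x) = 0 := by
    ext w
    obtain ⟨v, rfl⟩ := (chartEquiv he hx).surjective w
    rw [hF.fderiv_eq, chartEquiv_apply,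
      ← mvfderiv_eq_fderiv_chart he hx (mdifferentiableAt_coe f x), hdf v]
    simp
  obtain ⟨g, hgs, hgp, hg⟩ := exists_contDiff_sub_eq_apply hFs (e x)
  let b := Module.finBasis ℝ E
  have hsrc : e.source ∈ nhds x := e.open_source.mem_nhds hx
  have h1 : ∀ i, ∃ u : SmoothFun E M, (u : M → ℂ) =ᶠ[nhds x]
      (fun z ↦ ((b.coord i (z - e x) : ℝ) : ℂ)) ∘ e := fun i ↦
    exists_smoothFun_eventuallyEq hsrc fun y hy ↦ contMDiffAt_comp_chart he hy <|
      ((Complex.ofRealCLM ∘L (b.coord i).toContinuousLinearMap).contDiff.comp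
        (contDiff_id.sub contDiff_const)).contDiffAt
  have h2 : ∀ i, ∃ u : SmoothFun E M, (u : M → ℂ) =ᶠ[nhds x] (fun z ↦ g z (b i)) ∘ e := fun i ↦
    exists_smoothFun_eventuallyEq hsrc fun y hy ↦ contMDiffAt_comp_chart he hy <|
      (hgs.clm_apply contDiff_const).contDiffAt
  choose u hu using h1
  choose w hw using h2
  -- Near `x`, `f` is the sum of the centered coordinates `u i` times the Hadamard coefficients `w
  -- i`. The latter vanish at `x` too, because there they are components of the zero derivative.
  have hmem : ∑ i, u i * w i ∈ idealAt E x ^ 2 := by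
    rw [pow_two]
    refine Ideal.sum_mem _ fun i _ ↦ Ideal.mul_mem_mul (mem_idealAt.2 ?_) (mem_idealAt.2 ?_)
    · rw [(hu i).eq_of_nhds]; simp
    · rw [(hw i).eq_of_nhds]; simp [hgp, hdF]
  have hzero : ((f - ∑ i, u i * w i : SmoothFun E M) : M → ℂ) =ᶠ[nhds x] 0 := by
    have hF' : ∀ᶠ y in nhds x, F (e y) = (f : M → ℂ) (e.symm (e y)) :=
      (e.continuousAt hx).eventually hF
    filter_upwards [hF', hsrc, Filter.eventually_all.2 hu, Filter.eventually_all.2 hw]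
      with y h1 h2 h3 h4
    rw [e.left_inv h2] at h1
    have h5 : ((f - ∑ i, u i * w i : SmoothFun E M) : M → ℂ) y =
        (f : M → ℂ) y - ∑ i, (u i : M → ℂ) y * (w i : M → ℂ) y := by
      simp [Finset.sum_apply]
    rw [h5, ← h1, hg, hFp, zero_add, Pi.zero_apply, sub_eq_zero]
    conv_lhs => rw [← b.sum_repr (e y - e x)]
    rw [map_sum]
    refine Finset.sum_congr rfl fun i _ ↦ ?_
    rw [h3 i, h4 i, map_smul]
    simp
  have := Ideal.add_mem _ (mem_idealAt_pow_of_eventuallyEq_zero hzero 2) hmem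
  simpa using this

/-- Two functions in `𝔪_x` with the same differential at `x` are congruent modulo `𝔪_x ^ 2`. -/
theorem sub_mem_idealAt_sq {x : M} {f g : SmoothFun E M} (hf : f ∈ idealAt E x)
    (hg : g ∈ idealAt E x)
    (h : ∀ v, mvfderiv 𝓘(ℝ, E) (f : M → ℂ) x v = mvfderiv 𝓘(ℝ, E) (g : M → ℂ) x v) :
    f - g ∈ idealAt E x ^ 2 := by
  refine mem_idealAt_sq (mem_idealAt.1 ((idealAt E x).sub_mem hf hg)) fun v ↦ ?_
  rw [mvfderiv_coe_sub, _root_.sub_apply, h, sub_self]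

end Ideals

end

section

variable {E : Type*} [NormedAddCommGroup E] [NormedSpace ℝ E]
  {M : Type*} [TopologicalSpace M] [ChartedSpace E M]

/-! ### Contraction -/

section Contraction

variable [FiniteDimensional ℝ E] {r : ℕ} {x : M}

variable (E) in
/-- The basis of the tangent space that is used for contractions. -/
def tangentBasis (x : M) :
    Module.Basis (Fin (Module.finrank ℝ E)) ℝ (TangentSpace 𝓘(ℝ, E) x) :=
  Module.finBasis ℝ E

theorem contract_eq (Φ : ContraTensor E r x) (η : CoTensor E r x) :
    contract Φ η = ∑ i : Fin r → Fin (Module.finrank ℝ E),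
      Φ (fun k ↦ (tangentBasis E x).coord (i k)) * η (fun k ↦ tangentBasis E x (i k)) :=
  rfl

theorem contract_add_left (Φ Ψ : ContraTensor E r x) (η : CoTensor E r x) :
    contract (Φ + Ψ) η = contract Φ η + contract Ψ η := by
  simp [contract_eq, add_mul, Finset.sum_add_distrib]

theorem contract_smul_left (c : ℂ) (Φ : ContraTensor E r x) (η : CoTensor E r x) :
    contract (c • Φ) η = c * contract Φ η := by
  simp [contract_eq, Finset.mul_sum, mul_assoc]

theorem contract_add_right (Φ : ContraTensor E r x) (η θ : CoTensor E r x) :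
    contract Φ (η + θ) = contract Φ η + contract Φ θ := by
  simp [contract_eq, mul_add, Finset.sum_add_distrib]

theorem contract_smul_right (Φ : ContraTensor E r x) (c : ℂ) (η : CoTensor E r x) :
    contract Φ (c • η) = c * contract Φ η := by
  simp [contract_eq, Finset.mul_sum, mul_left_comm]

theorem contract_zero_right (Φ : ContraTensor E r x) : contract Φ (0 : CoTensor E r x) = 0 := by
  simp [contract_eq]

theorem contract_sum_right {ι : Type*} (s : Finset ι) (Φ : ContraTensor E r x)
    (η : ι → CoTensor E r x) :
    contract Φ (fun v ↦ ∑ j ∈ s, η j v) = ∑ j ∈ s, contract Φ (η j) := by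
  simp only [contract_eq, Finset.mul_sum]
  exact Finset.sum_comm

/-- Permuting the arguments of `η` is a reindexing of the multi-indices, which the symmetry of `Φ`
absorbs. -/
theorem contract_comp_perm {Φ : ContraTensor E r x}
    (hΦ : ∀ (π : Equiv.Perm (Fin r)) ξ, Φ (fun k ↦ ξ (π k)) = Φ ξ) (η : CoTensor E r x)
    (π : Equiv.Perm (Fin r)) : contract Φ (fun v ↦ η fun k ↦ v (π k)) = contract Φ η := by
  rw [contract_eq, contract_eq]
  refine Fintype.sum_equiv (Equiv.arrowCongr π.symm (Equiv.refl _)) _ _ fun i ↦ ?_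
  rw [← hΦ π fun k ↦ (tangentBasis E x).coord (i k)]
  rfl

/-- All `r!` permuted terms contribute equally. Hence the symmetrization in `quantized` can be
dropped. -/
theorem contract_symmetrize {Φ : ContraTensor E r x}
    (hΦ : ∀ (π : Equiv.Perm (Fin r)) ξ, Φ (fun k ↦ ξ (π k)) = Φ ξ) (η : CoTensor E r x) :
    contract Φ (symmetrize η) = contract Φ η := by
  have : (symmetrize η : CoTensor E r x) = (r.factorial : ℂ)⁻¹ •
      (fun v ↦ ∑ π : Equiv.Perm (Fin r), η fun k ↦ v (π k) : CoTensor E r x) := rfl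
  rw [this, contract_smul_right, contract_sum_right, Finset.sum_congr rfl fun π _ ↦
    contract_comp_perm hΦ η π, Finset.sum_const, Finset.card_univ, Fintype.card_perm,
    Fintype.card_fin, nsmul_eq_mul, ← mul_assoc,
    inv_mul_cancel₀ (Nat.cast_ne_zero.2 r.factorial_ne_zero), one_mul]

theorem contract_sum_perm {Φ : ContraTensor E r x}
    (hΦ : ∀ (π : Equiv.Perm (Fin r)) ξ, Φ (fun k ↦ ξ (π k)) = Φ ξ) (η : CoTensor E r x) :
    contract Φ (fun v ↦ ∑ π : Equiv.Perm (Fin r), η fun k ↦ v (π k)) =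
      r.factorial * contract Φ η := by
  rw [contract_sum_right, Finset.sum_congr rfl fun π _ ↦ contract_comp_perm hΦ η π]
  simp [Fintype.card_perm]

/-- The contraction of `Φ` with `ξ_1 ⊗ ⋯ ⊗ ξ_r`. -/
theorem contract_prod (Φ : ContraTensor E r x)
    (ξ : Fin r → Module.Dual ℝ (TangentSpace 𝓘(ℝ, E) x)) :
    contract Φ (fun v ↦ ∏ k, (ξ k (v k) : ℂ)) = Φ ξ := by
  have h : ξ = fun k ↦ ∑ i, ξ k (tangentBasis E x i) • (tangentBasis E x).coord i := by
    ext1 k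
    refine (tangentBasis E x).ext fun j ↦ ?_
    simp
  conv_rhs => rw [h, MultilinearMap.map_sum]
  rw [contract_eq]
  refine Finset.sum_congr rfl fun i _ ↦ ?_
  rw [MultilinearMap.map_smul_univ, Complex.real_smul, mul_comm]
  push_cast
  rfl

/-- The contraction with a multilinear `η` can be computed in any basis. -/
theorem contract_eq_of_equiv (Φ : ContraTensor E r x)
    (η : MultilinearMap ℝ (fun _ : Fin r ↦ TangentSpace 𝓘(ℝ, E) x) ℂ)
    {ι F : Type*} [Fintype ι] [AddCommGroup F] [Module ℝ F]
    (A : TangentSpace 𝓘(ℝ, E) x ≃ₗ[ℝ] F) (b : Module.Basis ι ℝ F) :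
    contract Φ (fun v ↦ η v) =
      ∑ i : Fin r → ι, Φ (fun k ↦ (b.coord (i k)).comp A.toLinearMap) *
        η (fun k ↦ A.symm (b (i k))) := by
  classical
  have h1 : (fun v ↦ η v : CoTensor E r x) = fun v ↦ ∑ i : Fin r → ι,
      (η (fun k ↦ A.symm (b (i k))) • (fun v ↦ ∏ k, ((b.coord (i k)).comp A.toLinearMap (v k) : ℂ) :
        CoTensor E r x)) v := by
    ext v
    have hv : v = fun k ↦ ∑ j, b.coord j (A (v k)) • A.symm (b j) := by
      ext1 k
      apply A.injective
      rw [map_sum]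
      conv_lhs => rw [← b.sum_repr (A (v k))]
      simp
    conv_lhs => rw [hv, MultilinearMap.map_sum]
    refine Finset.sum_congr rfl fun i _ ↦ ?_
    rw [MultilinearMap.map_smul_univ, Complex.real_smul, mul_comm]
    push_cast
    rfl
  rw [h1, contract_sum_right]
  refine Finset.sum_congr rfl fun i _ ↦ ?_
  rw [contract_smul_right, contract_prod, mul_comm]

end Contraction

/-! ### Powers of ideals -/

/-- To prove a property of the elements of `I ^ n` it suffices to look at products. -/
theorem idealPow_induction {A : Type*} [CommRing A] (I : Ideal A) (n : ℕ) {C : A → Prop}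
    (add : ∀ f g, C f → C g → C (f + g))
    (prod : ∀ (a : A) (f : Fin n → A), (∀ k, f k ∈ I) → C (a * ∏ k, f k)) :
    ∀ f ∈ I ^ n, C f := by
  induction n generalizing C with
  | zero => intro f _; simpa using prod f Fin.elim0 (fun k ↦ k.elim0)
  | succ n ih =>
    intro f hf
    rw [pow_succ'] at hf
    refine Submodule.mul_induction_on hf (fun m hm g hg ↦ ?_) add
    refine ih (C := fun g ↦ C (m * g)) (fun f g h1 h2 ↦ by rw [mul_add]; exact add _ _ h1 h2)
      (fun a f hf ↦ ?_) g hg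
    have := prod a (Fin.cons m f) (Fin.cases hm hf)
    rw [Fin.prod_univ_succ] at this
    simpa [mul_left_comm] using this

theorem sub_const_mem_idealAt (a : SmoothFun E M) (x : M) :
    a - algebraMap ℂ (SmoothFun E M) ((a : M → ℂ) x) ∈ idealAt E x :=
  mem_idealAt.2 (sub_self ((a : M → ℂ) x))

theorem prod_mem_idealAt_pow {x : M} {r : ℕ} {f : Fin r → SmoothFun E M}
    (hf : ∀ k, f k ∈ idealAt E x) : ∏ k, f k ∈ idealAt E x ^ r := by
  have := Ideal.prod_mem_prod (s := Finset.univ) (I := fun _ : Fin r ↦ idealAt E x)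
    fun k _ ↦ hf k
  simpa using this

/-- To prove a property of the elements of `𝔪_x ^ r` that holds on `𝔪_x ^ (r + 1)` it suffices
to look at products of `r` functions in `𝔪_x`. -/
theorem idealAt_pow_induction {x : M} {r : ℕ} {C : SmoothFun E M → Prop}
    (add : ∀ f g, C f → C g → C (f + g)) (smul : ∀ (c : ℂ) f, C f → C (c • f))
    (pow_succ : ∀ f ∈ idealAt E x ^ (r + 1), C f)
    (prod : ∀ f : Fin r → SmoothFun E M, (∀ k, f k ∈ idealAt E x) → C (∏ k, f k)) :
    ∀ f ∈ idealAt E x ^ r, C f := by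
  refine idealPow_induction _ r add fun a f hf ↦ ?_
  -- Only the value of the coefficient `a` at `x` matters: `a - a(x)` is one more factor in `𝔪_x`.
  have : a * ∏ k, f k = (a - algebraMap ℂ (SmoothFun E M) ((a : M → ℂ) x)) * ∏ k, f k +
      (a : M → ℂ) x • ∏ k, f k := by
    rw [Algebra.smul_def]; ring
  rw [this]
  refine add _ _ (pow_succ _ ?_) (smul _ _ (prod f hf))
  rw [_root_.pow_succ']
  exact Ideal.mul_mem_mul (sub_const_mem_idealAt a x) (prod_mem_idealAt_pow hf)

/-! ### Differentials of order `r` in a chart -/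

section ChartDiff

variable {e : OpenPartialHomeomorph M E} {x : M} {r : ℕ}

theorem contDiffAt_coe_comp_symm (he : e ∈ IsManifold.maximalAtlas 𝓘(ℝ, E) ∞ M)
    (hx : x ∈ e.source) (f : SmoothFun E M) : ContDiffAt ℝ ∞ ((f : M → ℂ) ∘ e.symm) (e x) :=
  contDiffAt_comp_chart_symm he hx (contMDiff_coe f).contMDiffAt

/-- Each factor from `𝔪_x` adds one order of vanishing, by `VanishesToOrder.bilinear` for the
multiplication of `ℂ`. This translates the algebraic notion of order into derivatives in a chart. -/
theorem vanishesToOrder_of_mem_idealAt_pow (he : e ∈ IsManifold.maximalAtlas 𝓘(ℝ, E) ∞ M)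
    (hx : x ∈ e.source) {k : ℕ} {f : SmoothFun E M} (hf : f ∈ idealAt E x ^ k) :
    VanishesToOrder k ((f : M → ℂ) ∘ e.symm) (e x) := by
  induction k generalizing f with
  | zero => exact .of_contDiffAt (contDiffAt_coe_comp_symm he hx f)
  | succ k ih =>
    rw [pow_succ'] at hf
    refine Submodule.mul_induction_on hf (fun m hm g hg ↦ ?_) fun f g hf hg ↦ hf.add hg
    have h1 : VanishesToOrder 1 ((m : M → ℂ) ∘ e.symm) (e x) :=
      .of_eq_zero (contDiffAt_coe_comp_symm he hx m) (by
        simpa [e.left_inv hx] using mem_idealAt.1 hm)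
    rw [add_comm]
    exact h1.bilinear (ContinuousLinearMap.mul ℝ ℂ) (ih hg)

theorem chartDiff_add (he : e ∈ IsManifold.maximalAtlas 𝓘(ℝ, E) ∞ M) (hx : x ∈ e.source)
    (f g : SmoothFun E M) :
    chartDiff e r ((f + g : SmoothFun E M) : M → ℂ) x = chartDiff e r f x + chartDiff e r g x := by
  ext v
  have := iteratedFDeriv_add_apply (𝕜 := ℝ) (i := r)
    ((contDiffAt_coe_comp_symm he hx f).of_le (mod_cast le_top))
    ((contDiffAt_coe_comp_symm he hx g).of_le (mod_cast le_top))
  exact congrArg (fun m ↦ m fun k ↦ mvfderiv 𝓘(ℝ, E) e x (v k)) this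

theorem chartDiff_smul (he : e ∈ IsManifold.maximalAtlas 𝓘(ℝ, E) ∞ M) (hx : x ∈ e.source)
    (c : ℂ) (f : SmoothFun E M) :
    chartDiff e r ((c • f : SmoothFun E M) : M → ℂ) x = c • chartDiff e r f x := by
  ext v
  have := iteratedFDeriv_const_smul_apply (𝕜 := ℝ) (i := r) (a := c)
    ((contDiffAt_coe_comp_symm he hx f).of_le (mod_cast le_top))
  exact congrArg (fun m ↦ m fun k ↦ mvfderiv 𝓘(ℝ, E) e x (v k)) this

theorem chartDiff_eq_zero (he : e ∈ IsManifold.maximalAtlas 𝓘(ℝ, E) ∞ M) (hx : x ∈ e.source)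
    {f : SmoothFun E M} (hf : f ∈ idealAt E x ^ (r + 1)) : chartDiff e r f x = 0 := by
  ext v
  rw [chartDiff, (vanishesToOrder_of_mem_idealAt_pow he hx hf).2 r (Nat.lt_succ_self r)]
  rfl

theorem chartDiff_congr (hx : x ∈ e.source) {f g : M → ℂ} (hfg : f =ᶠ[nhds x] g) :
    chartDiff e r f x = chartDiff e r g x := by
  have h : f ∘ e.symm =ᶠ[nhds (e x)] g ∘ e.symm := by
    have := e.continuousAt_symm (e.map_source hx)
    rw [ContinuousAt, e.left_inv hx] at this
    exact this.eventually hfg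
  ext v
  rw [chartDiff, chartDiff, (h.iteratedFDeriv (𝕜 := ℝ) r).eq_of_nhds]

variable [IsManifold 𝓘(ℝ, E) ∞ M] [FiniteDimensional ℝ E] [T2Space M]

/-- The `r`-th differential at `x` of a product of `r` functions that vanish at `x`. -/
theorem chartDiff_prod (he : e ∈ IsManifold.maximalAtlas 𝓘(ℝ, E) ∞ M) (hx : x ∈ e.source)
    {f : Fin r → SmoothFun E M} (hf : ∀ k, f k ∈ idealAt E x) :
    chartDiff e r ((∏ k, f k : SmoothFun E M) : M → ℂ) x =
      fun v ↦ ∑ π : Equiv.Perm (Fin r), ∏ k, mvfderiv 𝓘(ℝ, E) (f k : M → ℂ) x (v (π k)) := by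
  -- Each factor is replaced by a function that is linear in the centered chart near `x` and has the
  -- same differential there; the product changes by an element of `𝔪_x ^ (r + 1)`, invisible to the
  -- `r`-th differential. The new product is a multilinear map on the diagonal, whose `r`-th
  -- derivative is its sum over permutations.
  let L : Fin r → E →L[ℝ] ℂ := fun k ↦ fderiv ℝ ((f k : M → ℂ) ∘ e.symm) (e x)
  have hL : ∀ k v, mvfderiv 𝓘(ℝ, E) (f k : M → ℂ) x v = L k (mvfderiv 𝓘(ℝ, E) e x v) :=
    fun k v ↦ mvfderiv_eq_fderiv_chart he hx (mdifferentiableAt_coe (f k) x) v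
  have h1 : ∀ k, ∃ u : SmoothFun E M, (u : M → ℂ) =ᶠ[nhds x] (fun z ↦ L k (z - e x)) ∘ e :=
    fun k ↦ exists_smoothFun_eventuallyEq (e.open_source.mem_nhds hx) fun y hy ↦
      contMDiffAt_comp_chart he hy
        ((L k).contDiff.comp (contDiff_id.sub contDiff_const)).contDiffAt
  choose u hu using h1
  have hum : ∀ k, u k ∈ idealAt E x := fun k ↦ mem_idealAt.2 (by rw [(hu k).eq_of_nhds]; simp)
  have hud : ∀ k v, mvfderiv 𝓘(ℝ, E) (u k : M → ℂ) x v = L k (mvfderiv 𝓘(ℝ, E) e x v) :=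
    fun k v ↦ by
      have hd : HasFDerivAt (fun z ↦ L k (z - e x)) (L k) (e x) :=
        (L k).hasFDerivAt.comp (e x) ((hasFDerivAt_id _).sub_const _)
      rw [mvfderiv_congr (hu k), mvfderiv_comp_chart he hx hd.differentiableAt, hd.fderiv]
  have hdiff : ∏ k, f k - ∏ k, u k ∈ idealAt E x ^ (r + 1) := by
    have := prod_sub_prod_mem_pow (idealAt E x) Finset.univ f u (fun k _ ↦ hf k)
      fun k _ ↦ sub_mem_idealAt_sq (hf k) (hum k) fun v ↦ by rw [hL, hud]
    simpa using this
  have h2 : chartDiff e r ((∏ k, f k : SmoothFun E M) : M → ℂ) x =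
      chartDiff e r ((∏ k, u k : SmoothFun E M) : M → ℂ) x := by
    rw [← sub_add_cancel (∏ k, f k) (∏ k, u k), chartDiff_add he hx,
      chartDiff_eq_zero he hx hdiff, zero_add]
  let m : E [×r]→L[ℝ] ℂ :=
    (ContinuousMultilinearMap.mkPiAlgebra ℝ (Fin r) ℂ).compContinuousLinearMap L
  let F : E → ℂ := fun z ↦ m fun _ ↦ z
  have h3 : ((∏ k, u k : SmoothFun E M) : M → ℂ) =ᶠ[nhds x] (fun z ↦ F (z - e x)) ∘ e := by
    filter_upwards [Filter.eventually_all.2 hu] with y hy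
    have : ((∏ k, u k : SmoothFun E M) : M → ℂ) y = ∏ k, (u k : M → ℂ) y := by
      simp [Finset.prod_apply]
    rw [this]
    simp [F, m, hy]
  have h4 : (((fun z ↦ F (z - e x)) ∘ e) ∘ e.symm) =ᶠ[nhds (e x)] fun z ↦ F (z - e x) := by
    filter_upwards [e.open_target.mem_nhds (e.map_source hx)] with z hz
    simp [e.right_inv hz]
  rw [h2, chartDiff_congr hx h3]
  ext v
  rw [chartDiff, (h4.iteratedFDeriv (𝕜 := ℝ) r).eq_of_nhds, iteratedFDeriv_comp_sub,
    ContinuousMultilinearMap.iteratedFDeriv_comp_diagonal]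
  simp [m, hL]

end ChartDiff

end

section

variable {E : Type*} [NormedAddCommGroup E] [NormedSpace ℝ E]
  {M : Type*} [TopologicalSpace M] [ChartedSpace E M]

/-! ### Functions with a given differential -/

theorem mvfderiv_coe_sum_smul [IsManifold 𝓘(ℝ, E) ∞ M] {ι : Type*} (s : Finset ι)
    (c : ι → ℂ) (f : ι → SmoothFun E M) (x : M)
    (v : TangentSpace 𝓘(ℝ, E) x) :
    mvfderiv 𝓘(ℝ, E) ((∑ i ∈ s, c i • f i : SmoothFun E M) : M → ℂ) x v =
      ∑ i ∈ s, c i * mvfderiv 𝓘(ℝ, E) (f i : M → ℂ) x v := by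
  classical
  let e := chartAt E x
  have he : e ∈ IsManifold.maximalAtlas 𝓘(ℝ, E) ∞ M := IsManifold.chart_mem_maximalAtlas x
  have hx : x ∈ e.source := mem_chart_source E x
  have hd : ∀ i, HasFDerivAt ((f i : M → ℂ) ∘ e.symm)
      (fderiv ℝ ((f i : M → ℂ) ∘ e.symm) (e x)) (e x) := fun i ↦
    (differentiableAt_comp_chart_symm he hx (mdifferentiableAt_coe (f i) x)).hasFDerivAt
  have h := HasFDerivAt.fun_sum (u := s) fun i _ ↦ (hd i).const_smul (c i)
  rw [mvfderiv_eq_fderiv_chart he hx (mdifferentiableAt_coe _ x)]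
  have h1 : ((∑ i ∈ s, c i • f i : SmoothFun E M) : M → ℂ) ∘ e.symm =
      fun z ↦ ∑ i ∈ s, c i • ((f i : M → ℂ) ∘ e.symm) z := by
    ext z
    simp [Finset.sum_apply]
  rw [h1]
  erw [h.fderiv]
  rw [_root_.sum_apply]
  refine Finset.sum_congr rfl fun i _ ↦ ?_
  rw [mvfderiv_eq_fderiv_chart he hx (mdifferentiableAt_coe _ x)]
  rfl

section CoordFun

variable [IsManifold 𝓘(ℝ, E) ∞ M] [FiniteDimensional ℝ E] [T2Space M]

theorem contMDiff_bump_smul_chart (x : M) (χ : SmoothBumpFunction 𝓘(ℝ, E) x) (ξ : Module.Dual ℝ E) :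
    ContMDiff 𝓘(ℝ, E) 𝓘(ℝ, ℂ) ∞
      fun y ↦ χ y • ((ξ (chartAt E x y - chartAt E x x) : ℝ) : ℂ) :=
  χ.contMDiff_smul fun _ hy ↦ ContMDiffAt.contMDiffWithinAt <|
    contMDiffAt_comp_chart (IsManifold.chart_mem_maximalAtlas x) hy <|
      ((Complex.ofRealCLM ∘L ξ.toContinuousLinearMap).contDiff.comp
        (contDiff_id.sub contDiff_const)).contDiffAt

/-- A bump function centered at `x`. -/
def bumpAt (x : M) : SmoothBumpFunction 𝓘(ℝ, E) x :=
  Classical.choice inferInstance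

/-- A smooth function that vanishes at `x` and has the differential `ξ` there; it depends linearly
on `ξ`. -/
def coordFun (x : M) : Module.Dual ℝ (TangentSpace 𝓘(ℝ, E) x) →ₗ[ℝ] SmoothFun E M where
  toFun ξ := ⟨_, contMDiff_bump_smul_chart (E := E) x (bumpAt x) ξ⟩
  map_add' ξ ζ := by
    ext y
    let d : TangentSpace 𝓘(ℝ, E) x := (chartAt E x y - chartAt E x x : E)
    change bumpAt (E := E) x y • (((ξ + ζ) d : ℝ) : ℂ) =
      bumpAt (E := E) x y • ((ξ d : ℝ) : ℂ) + bumpAt (E := E) x y • ((ζ d : ℝ) : ℂ)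
    rw [LinearMap.add_apply, Complex.ofReal_add, smul_add]
  map_smul' c ξ := by
    ext y
    let d : TangentSpace 𝓘(ℝ, E) x := (chartAt E x y - chartAt E x x : E)
    change bumpAt (E := E) x y • (((c • ξ) d : ℝ) : ℂ) = c • (bumpAt (E := E) x y • ((ξ d : ℝ) : ℂ))
    rw [LinearMap.smul_apply, smul_eq_mul, Complex.ofReal_mul, smul_comm c,
      Complex.real_smul (x := c)]

theorem coordFun_mem_idealAt (x : M) (ξ : Module.Dual ℝ (TangentSpace 𝓘(ℝ, E) x)) :
    coordFun x ξ ∈ idealAt E x := by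
  refine mem_idealAt.2 ?_
  change _ • ((ξ (chartAt E x x - chartAt E x x : E) : ℝ) : ℂ) = 0
  rw [sub_self]
  erw [map_zero]
  simp

theorem mvfderiv_coordFun (x : M) (ξ : Module.Dual ℝ (TangentSpace 𝓘(ℝ, E) x))
    (v : TangentSpace 𝓘(ℝ, E) x) :
    mvfderiv 𝓘(ℝ, E) (coordFun x ξ : M → ℂ) x v = (ξ v : ℂ) := by
  let ζ : E →L[ℝ] ℂ := Complex.ofRealCLM ∘L (LinearMap.toContinuousLinearMap (E := E) ξ)
  have hd : HasFDerivAt (fun z ↦ ζ (z - chartAt E x x)) ζ (chartAt E x x) :=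
    ζ.hasFDerivAt.comp _ ((hasFDerivAt_id _).sub_const _)
  have h : (coordFun x ξ : M → ℂ) =ᶠ[nhds x] (fun z ↦ ζ (z - chartAt E x x)) ∘ chartAt E x := by
    filter_upwards [(bumpAt (E := E) x).eventuallyEq_one] with y hy
    change (bumpAt (E := E) x) y •
      ((ξ (chartAt E x y - chartAt E x x : E) : ℝ) : ℂ) = _
    rw [hy, Pi.one_apply, one_smul]
    rfl
  rw [mvfderiv_congr h, mvfderiv_comp_chart (IsManifold.chart_mem_maximalAtlas x)
    (mem_chart_source E x) hd.differentiableAt, hd.fderiv, mvfderiv_chartAt_self]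
  rfl

end CoordFun

/-! ### Existence and uniqueness of symbols -/

section Symbol

variable {r : ℕ} {P : SmoothFun E M →ₗ[ℂ] SmoothFun E M}

theorem HasOrder.apply_eq (hP : HasOrder r P) {x : M} {f g : SmoothFun E M}
    (h : f - g ∈ idealAt E x ^ (r + 1)) : (P f : M → ℂ) x = (P g : M → ℂ) x := by
  have := mem_idealAt.1 (hP x _ h)
  rw [map_sub] at this
  exact sub_eq_zero.1 this

/-- The two products differ by an element of `𝔪_x ^ (r + 1)`. This is why the symbol is a tensor at
`x`. -/
theorem HasOrder.apply_prod_eq (hP : HasOrder r P) {x : M} {f g : Fin r → SmoothFun E M}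
    (hf : ∀ k, f k ∈ idealAt E x) (hfg : ∀ k, f k - g k ∈ idealAt E x ^ 2) :
    (P (∏ k, f k) : M → ℂ) x = (P (∏ k, g k) : M → ℂ) x := by
  refine hP.apply_eq ?_
  simpa using prod_sub_prod_mem_pow (idealAt E x) Finset.univ f g (fun k _ ↦ hf k) fun k _ ↦ hfg k

variable [IsManifold 𝓘(ℝ, E) ∞ M] [FiniteDimensional ℝ E] [T2Space M]

variable (r P) in
/-- The value at `x` of the symbol of order `r` of `P`. -/
def symbolAt (x : M) : ContraTensor E r x :=
  -- Linearity of `coordFun x` makes this multilinear by construction; `1 / r!` offsets the sum over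
  -- permutations in `chartDiff_prod`.
  (r.factorial : ℂ)⁻¹ • LinearMap.compMultilinearMap
    (((LinearMap.proj x).comp (SmoothFun E M).val.toLinearMap).comp P |>.restrictScalars ℝ)
    ((MultilinearMap.mkPiAlgebra ℝ (Fin r) (SmoothFun E M)).compLinearMap fun _ ↦ coordFun x)

theorem symbolAt_apply (x : M) (ξ : Fin r → Module.Dual ℝ (TangentSpace 𝓘(ℝ, E) x)) :
    symbolAt r P x ξ = (r.factorial : ℂ)⁻¹ * (P (∏ k, coordFun x (ξ k)) : M → ℂ) x :=
  rfl

theorem symbolAt_comp_perm (x : M) (π : Equiv.Perm (Fin r))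
    (ξ : Fin r → Module.Dual ℝ (TangentSpace 𝓘(ℝ, E) x)) :
    symbolAt r P x (fun k ↦ ξ (π k)) = symbolAt r P x ξ := by
  rw [symbolAt_apply, symbolAt_apply, Equiv.prod_comp π fun k ↦ coordFun x (ξ k)]

/-- No regularity of `coordFun x` in `x` is known, so smoothness of the symbol needs the freedom to
use other functions with the same differentials. -/
theorem symbolAt_eq (hP : HasOrder r P) {x : M}
    {ξ : Fin r → Module.Dual ℝ (TangentSpace 𝓘(ℝ, E) x)} {f : Fin r → SmoothFun E M}
    (hf : ∀ k, f k ∈ idealAt E x)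
    (hdf : ∀ k v, mvfderiv 𝓘(ℝ, E) (f k : M → ℂ) x v = (ξ k v : ℂ)) :
    symbolAt r P x ξ = (r.factorial : ℂ)⁻¹ * (P (∏ k, f k) : M → ℂ) x := by
  rw [symbolAt_apply, hP.apply_prod_eq (g := f) (fun k ↦ coordFun_mem_idealAt x (ξ k))]
  exact fun k ↦ sub_mem_idealAt_sq (coordFun_mem_idealAt x (ξ k)) (hf k) fun v ↦ by
    rw [mvfderiv_coordFun, hdf]

/-- The differentials of the `f k` are complex-valued, so each `f k` is replaced by a complex
combination of the functions `coordFun x` of the dual basis. Expanding the product then gives the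
contraction term by term. -/
theorem HasOrder.apply_prod (hP : HasOrder r P) {x : M} {f : Fin r → SmoothFun E M}
    (hf : ∀ k, f k ∈ idealAt E x) :
    (P (∏ k, f k) : M → ℂ) x = r.factorial *
      contract (symbolAt r P x) fun v ↦ ∏ k, mvfderiv 𝓘(ℝ, E) (f k : M → ℂ) x (v k) := by
  let b := tangentBasis E x
  let c : Fin r → Fin (Module.finrank ℝ E) → ℂ := fun k i ↦ mvfderiv 𝓘(ℝ, E) (f k : M → ℂ) x (b i)
  let g : Fin r → SmoothFun E M := fun k ↦ ∑ i, c k i • coordFun x (b.coord i)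
  have hg : ∀ k, g k ∈ idealAt E x := fun k ↦ Ideal.sum_mem _ fun i _ ↦ by
    rw [Algebra.smul_def]
    exact Ideal.mul_mem_left _ _ (coordFun_mem_idealAt x _)
  have hfg : ∀ k, f k - g k ∈ idealAt E x ^ 2 := fun k ↦
    sub_mem_idealAt_sq (hf k) (hg k) fun v ↦ by
      rw [mvfderiv_coe_sum_smul]
      simp only [mvfderiv_coordFun]
      conv_lhs => rw [← b.sum_repr v]
      rw [map_sum]
      refine Finset.sum_congr rfl fun i _ ↦ ?_
      rw [map_smul, Complex.real_smul, mul_comm]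
      rfl
  rw [hP.apply_prod_eq hf hfg, contract_eq, Finset.mul_sum]
  have hprod : ∏ k, g k = ∑ i : Fin r → Fin (Module.finrank ℝ E),
      (∏ k, c k (i k)) • ∏ k, coordFun x (b.coord (i k)) := by
    simp only [g]
    rw [Finset.prod_univ_sum, Fintype.piFinset_univ]
    refine Finset.sum_congr rfl fun i _ ↦ ?_
    simp only [Algebra.smul_def, Finset.prod_mul_distrib, map_prod]
  rw [hprod, map_sum]
  have hsum : ∀ (F : (Fin r → Fin (Module.finrank ℝ E)) → SmoothFun E M),
      ((∑ i, F i : SmoothFun E M) : M → ℂ) x = ∑ i, (F i : M → ℂ) x := fun F ↦ by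
    simp [Finset.sum_apply]
  rw [hsum]
  refine Finset.sum_congr rfl fun i _ ↦ ?_
  rw [symbolAt_apply, map_smul]
  change (∏ k, c k (i k)) * _ = _
  have : (r.factorial : ℂ) ≠ 0 := Nat.cast_ne_zero.2 r.factorial_ne_zero
  field_simp
  exact mul_comm _ _

/-- Fix `u k` that equals `ℓ k ∘ e` near `x`. For `y` near `x` the functions `u k - u k (y)` lie in
`𝔪_y` and have the required differentials. Expanding their product by linearity of `P` leaves
products of values `-u k (y)` with values at `y` of `P` on functions independent of `y`, all smooth
in `y`. -/
theorem contMDiffAt_symbolAt (hP : HasOrder r P) {e : OpenPartialHomeomorph M E}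
    (he : e ∈ IsManifold.maximalAtlas 𝓘(ℝ, E) ∞ M) (ℓ : Fin r → Module.Dual ℝ E) {x : M}
    (hx : x ∈ e.source) :
    ContMDiffAt 𝓘(ℝ, E) 𝓘(ℝ, ℂ) ∞
      (fun y ↦ symbolAt r P y fun k ↦ (ℓ k).comp (mvfderiv 𝓘(ℝ, E) e y).toLinearMap) x := by
  classical
  let L : Fin r → E →L[ℝ] ℂ := fun k ↦ Complex.ofRealCLM ∘L (ℓ k).toContinuousLinearMap
  have h1 : ∀ k, ∃ u : SmoothFun E M, (u : M → ℂ) =ᶠ[nhds x] L k ∘ e := fun k ↦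
    exists_smoothFun_eventuallyEq (e.open_source.mem_nhds hx) fun y hy ↦
      contMDiffAt_comp_chart he hy (L k).contDiff.contDiffAt
  choose u hu using h1
  have hev : ∀ᶠ y in nhds x,
      (symbolAt r P y fun k ↦ (ℓ k).comp (mvfderiv 𝓘(ℝ, E) e y).toLinearMap) =
        (r.factorial : ℂ)⁻¹ * ∑ t ∈ (Finset.univ : Finset (Fin r)).powerset,
          (∏ k ∈ Finset.univ \ t, -(u k : M → ℂ) y) * (P (∏ k ∈ t, u k) : M → ℂ) y := by
    filter_upwards [e.open_source.mem_nhds hx,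
      Filter.eventually_all.2 fun k ↦ (hu k).eventuallyEq_nhds] with y hy huy
    rw [symbolAt_eq hP (f := fun k ↦ u k + algebraMap ℂ (SmoothFun E M) (-(u k : M → ℂ) y))]
    · congr 1
      rw [Finset.prod_add]
      have : ∀ t : Finset (Fin r), (∏ k ∈ t, u k) * ∏ k ∈ Finset.univ \ t,
          algebraMap ℂ (SmoothFun E M) (-(u k : M → ℂ) y) =
          (∏ k ∈ Finset.univ \ t, -(u k : M → ℂ) y) • ∏ k ∈ t, u k := fun t ↦ by
        rw [Algebra.smul_def, map_prod, mul_comm]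
      simp only [this, map_sum, map_smul]
      simp [Finset.sum_apply]
    · exact fun k ↦ mem_idealAt.2 (add_neg_cancel ((u k : M → ℂ) y))
    · intro k v
      rw [mvfderiv_coe_add]
      have h0 : mvfderiv 𝓘(ℝ, E)
          ((algebraMap ℂ (SmoothFun E M) (-(u k : M → ℂ) y) : SmoothFun E M) : M → ℂ) y = 0 :=
        mvfderiv_const _
      rw [h0, add_zero, mvfderiv_congr (huy k),
        mvfderiv_comp_chart he hy (L k).differentiableAt, (L k).fderiv]
      rfl
  refine ContMDiffAt.congr_of_eventuallyEq ?_ hev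
  refine contMDiffAt_mul contMDiffAt_const
    (ContMDiffAt.sum fun t _ ↦ contMDiffAt_mul ?_ (contMDiff_coe _).contMDiffAt)
  have : (fun y ↦ ∏ k ∈ Finset.univ \ t, -(u k : M → ℂ) y) =
      ((∏ k ∈ Finset.univ \ t, -u k : SmoothFun E M) : M → ℂ) := by
    ext y
    simp [Finset.prod_apply]
  rw [this]
  exact (contMDiff_coe _).contMDiffAt

/-- The symbol of order `r` of an operator of order `r`. -/
def symbol (hP : HasOrder r P) : SymTensorField E M r :=
  ⟨symbolAt r P, fun x π ξ ↦ symbolAt_comp_perm x π ξ, fun _ he ℓ _ hx ↦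
    (contMDiffAt_symbolAt hP he ℓ hx).contMDiffWithinAt⟩

theorem contract_chartDiff_prod {e : OpenPartialHomeomorph M E}
    (he : e ∈ IsManifold.maximalAtlas 𝓘(ℝ, E) ∞ M) {x : M} (hx : x ∈ e.source)
    (σ : SymTensorField E M r) {f : Fin r → SmoothFun E M} (hf : ∀ k, f k ∈ idealAt E x) :
    contract (σ.1 x) (chartDiff e r ((∏ k, f k : SmoothFun E M) : M → ℂ) x) = r.factorial *
      contract (σ.1 x) fun v ↦ ∏ k, mvfderiv 𝓘(ℝ, E) (f k : M → ℂ) x (v k) := by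
  rw [chartDiff_prod he hx hf]
  exact contract_sum_perm (σ.2.1 x) fun v ↦ ∏ k, mvfderiv 𝓘(ℝ, E) (f k : M → ℂ) x (v k)

/-- The symbol condition has to be checked on products only. -/
theorem isSymbol_of_prod (hP : HasOrder r P) {σ : SymTensorField E M r}
    (h : ∀ (x : M) (f : Fin r → SmoothFun E M), (∀ k, f k ∈ idealAt E x) →
      (P (∏ k, f k) : M → ℂ) x = r.factorial *
        contract (σ.1 x) fun v ↦ ∏ k, mvfderiv 𝓘(ℝ, E) (f k : M → ℂ) x (v k)) :
    IsSymbol r P σ := by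
  refine ⟨hP, fun x f hf e he hx ↦ ?_⟩
  refine idealAt_pow_induction (C := fun f : SmoothFun E M ↦ (P f : M → ℂ) x =
    contract (σ.1 x) (chartDiff e r f x)) (fun f g h1 h2 ↦ ?_) (fun c f h1 ↦ ?_) (fun f hf ↦ ?_)
    (fun f hf ↦ ?_) f hf
  · rw [chartDiff_add he hx, contract_add_right, ← h1, ← h2, map_add]
    rfl
  · rw [chartDiff_smul he hx, contract_smul_right, ← h1, map_smul]
    rfl
  · rw [chartDiff_eq_zero he hx hf, contract_zero_right]
    exact mem_idealAt.1 (hP x f hf)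
  · rw [contract_chartDiff_prod he hx σ hf, h x f hf]

theorem isSymbol_symbol (hP : HasOrder r P) : IsSymbol r P (symbol hP) :=
  isSymbol_of_prod hP fun _ _ hf ↦ hP.apply_prod hf

/-- Products of the `coordFun` test every component of a symbol, whence its uniqueness. -/
theorem IsSymbol.apply_prod {σ : SymTensorField E M r} (h : IsSymbol r P σ) {x : M}
    (ξ : Fin r → Module.Dual ℝ (TangentSpace 𝓘(ℝ, E) x)) :
    (P (∏ k, coordFun x (ξ k)) : M → ℂ) x = r.factorial * σ.1 x ξ := by
  have hf : ∀ k, coordFun x (ξ k) ∈ idealAt E x := fun k ↦ coordFun_mem_idealAt x (ξ k)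
  have he := IsManifold.chart_mem_maximalAtlas (I := 𝓘(ℝ, E)) (n := ∞) x
  rw [h.2 x _ (prod_mem_idealAt_pow hf) _ he (mem_chart_source E x),
    contract_chartDiff_prod he (mem_chart_source E x) σ hf]
  simp only [mvfderiv_coordFun]
  rw [contract_prod]

theorem IsSymbol.unique {σ τ : SymTensorField E M r} (hσ : IsSymbol r P σ) (hτ : IsSymbol r P τ) :
    σ = τ := by
  ext x ξ
  have : (r.factorial : ℂ) ≠ 0 := Nat.cast_ne_zero.2 r.factorial_ne_zero
  exact mul_left_cancel₀ this ((hσ.apply_prod ξ).symm.trans (hτ.apply_prod ξ))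

end Symbol

end

section

variable {E : Type*} [NormedAddCommGroup E] [NormedSpace ℝ E]
  {M : Type*} [TopologicalSpace M] [ChartedSpace E M]

/-! ### Connections in charts -/

section Connection

open scoped Bundle

variable [IsManifold 𝓘(ℝ, E) ∞ M] {x₀ y : M}

/-- This turns regularity of sections of the tangent bundle into regularity of `E`-valued functions.
-/
theorem trivializationAt_snd (hy : y ∈ (chartAt E x₀).source) (v : TangentSpace 𝓘(ℝ, E) y) :
    (trivializationAt E (TangentSpace 𝓘(ℝ, E)) x₀ ⟨y, v⟩).2 =
      mvfderiv 𝓘(ℝ, E) (chartAt E x₀) y v := by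
  have h := TangentBundle.continuousLinearMapAt_trivializationAt (I := 𝓘(ℝ, E)) hy
  rw [extChartAt_coe] at h
  have h2 : (trivializationAt E (TangentSpace 𝓘(ℝ, E)) x₀).continuousLinearMapAt ℝ y v =
      mvfderiv 𝓘(ℝ, E) (chartAt E x₀) y v := by rw [h]; rfl
  rw [← h2, Bundle.Trivialization.continuousLinearMapAt_apply,
    Bundle.Trivialization.coe_linearMapAt_of_mem _ hy]

theorem eventuallyEq_trivializationAt_snd (hy : y ∈ (chartAt E x₀).source)
    (X : (z : M) → TangentSpace 𝓘(ℝ, E) z) :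
    (fun z ↦ mvfderiv 𝓘(ℝ, E) (chartAt E x₀) z (X z)) =ᶠ[nhds y]
      fun z ↦ (trivializationAt E (TangentSpace 𝓘(ℝ, E)) x₀ ⟨z, X z⟩).2 := by
  filter_upwards [(chartAt E x₀).open_source.mem_nhds hy] with z hz
  rw [trivializationAt_snd hz]

theorem mdifferentiableAt_chart_section (hy : y ∈ (chartAt E x₀).source)
    {X : (z : M) → TangentSpace 𝓘(ℝ, E) z} (hX : MDiffAt (T% X) y) :
    MDifferentiableAt 𝓘(ℝ, E) 𝓘(ℝ, E)
      (fun z ↦ mvfderiv 𝓘(ℝ, E) (chartAt E x₀) z (X z)) y := by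
  have := ((trivializationAt E (TangentSpace 𝓘(ℝ, E)) x₀).mdifferentiableAt_section_iff
    𝓘(ℝ, E) X hy).1 hX
  exact this.congr_of_eventuallyEq (eventuallyEq_trivializationAt_snd hy X)

theorem contMDiffAt_chart_section (hy : y ∈ (chartAt E x₀).source)
    {X : (z : M) → TangentSpace 𝓘(ℝ, E) z} (hX : CMDiffAt ∞ (T% X) y) :
    ContMDiffAt 𝓘(ℝ, E) 𝓘(ℝ, E) ∞
      (fun z ↦ mvfderiv 𝓘(ℝ, E) (chartAt E x₀) z (X z)) y := by
  have := ((trivializationAt E (TangentSpace 𝓘(ℝ, E)) x₀).contMDiffAt_section_iff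
    (n := ∞) (IB := 𝓘(ℝ, E)) hy).1 hX
  exact this.congr_of_eventuallyEq (eventuallyEq_trivializationAt_snd hy X)

theorem nabla_sum_smul (nabla : CovariantDerivative 𝓘(ℝ, E) E (TangentSpace 𝓘(ℝ, E) : M → Type _))
    {ι : Type*} (s : Finset ι) {c : ι → M → ℝ} {Z : ι → (z : M) → TangentSpace 𝓘(ℝ, E) z}
    (hc : ∀ i, MDiffAt (c i) y) (hZ : ∀ i, MDiffAt (T% (Z i)) y) (v : TangentSpace 𝓘(ℝ, E) y) :
    nabla (∑ i ∈ s, c i • Z i) y v =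
      ∑ i ∈ s, (c i y • nabla (Z i) y v + mvfderiv 𝓘(ℝ, E) (c i) y v • Z i y) := by
  classical
  induction s using Finset.induction_on with
  | empty =>
    rw [Finset.sum_empty, Finset.sum_empty, CovariantDerivative.zero]
    rfl
  | insert a s ha ih =>
    rw [Finset.sum_insert ha, Finset.sum_insert ha, nabla.isCovariantDerivativeOnUniv.add,
      nabla.isCovariantDerivativeOnUniv.leibniz (hZ a) (hc a), ← ih]
    · rfl
    · exact (hc a).smul_section (hZ a)
    · have := MDifferentiableAt.sum_section (𝕜 := ℝ) (I := 𝓘(ℝ, E)) (s := s) (x₀ := y)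
        (t := fun i ↦ c i • Z i) fun i _ ↦ (hc i).smul_section (hZ i)
      convert! this using 3
      simp

/-- `U` is an open neighborhood of `x₀` in the domain of the chart at `x₀` on which the connection
is given by the smooth Christoffel symbols `Γ`. -/
structure IsChristoffel
    (nabla : CovariantDerivative 𝓘(ℝ, E) E (TangentSpace 𝓘(ℝ, E) : M → Type _)) (x₀ : M)
    (U : Set M) (Γ : E → E →L[ℝ] E →L[ℝ] E) : Prop where
  isOpen : IsOpen U
  mem : x₀ ∈ U
  subset : U ⊆ (chartAt E x₀).source
  contDiffAt : ∀ y ∈ U, ContDiffAt ℝ ∞ Γ (chartAt E x₀ y)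
  nabla_eq : ∀ y ∈ U, ∀ (X : (z : M) → TangentSpace 𝓘(ℝ, E) z), MDiffAt (T% X) y →
    ∀ v : TangentSpace 𝓘(ℝ, E) y, mvfderiv 𝓘(ℝ, E) (chartAt E x₀) y (nabla X y v) =
      mvfderiv 𝓘(ℝ, E) (fun z ↦ mvfderiv 𝓘(ℝ, E) (chartAt E x₀) z (X z)) y v +
      Γ (chartAt E x₀ y) (mvfderiv 𝓘(ℝ, E) (chartAt E x₀) y v)
        (mvfderiv 𝓘(ℝ, E) (chartAt E x₀) y (X y))

variable [FiniteDimensional ℝ E] [T2Space M]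

/-- Smooth vector fields that form the coordinate frame near `x₀`. -/
theorem exists_frame (x₀ : M) {ι : Type*} [Fintype ι] (b : Module.Basis ι ℝ E) :
    ∃ Z : ι → (z : M) → TangentSpace 𝓘(ℝ, E) z, (∀ i, CMDiff ∞ (T% (Z i))) ∧
      ∀ᶠ z in nhds x₀, ∀ i, mvfderiv 𝓘(ℝ, E) (chartAt E x₀) z (Z i z) = b i := by
  let t := trivializationAt E (TangentSpace 𝓘(ℝ, E) : M → Type _) x₀
  let χ := bumpAt (E := E) x₀
  -- The cutoff makes the local coordinate frame global without changing it near `x₀`.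
  refine ⟨fun i ↦ (χ : M → ℝ) • t.localFrame b i, fun i ↦ ?_, ?_⟩
  · exact ContMDiffOn.smul_section_of_tsupport χ.contMDiff.contMDiffOn t.open_baseSet
      χ.tsupport_subset_chartAt_source (t.contMDiffOn_localFrame_baseSet ∞ b i)
  · filter_upwards [χ.eventuallyEq_one, (chartAt E x₀).open_source.mem_nhds (mem_chart_source E x₀)]
      with z hz hzs i
    rw [← trivializationAt_snd hzs]
    change (t ⟨z, χ z • t.localFrame b i z⟩).2 = b i
    rw [hz, Pi.one_apply, one_smul, t.localFrame_apply_of_mem_baseSet b hzs]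
    change (t ⟨z, t.symm z (b i)⟩).2 = b i
    rw [t.apply_mk_symm hzs]

set_option synthInstance.maxHeartbeats 200000 in
/-- In the coordinates of the chart at `x₀` a smooth connection is, near `x₀`, the flat one plus
smooth Christoffel symbols. -/
theorem exists_christoffel
    {nabla : CovariantDerivative 𝓘(ℝ, E) E (TangentSpace 𝓘(ℝ, E) : M → Type _)}
    (hsmooth : CovariantDerivative.ContMDiffCovariantDerivative nabla ∞) (x₀ : M) :
    ∃ (U : Set M) (Γ : E → E →L[ℝ] E →L[ℝ] E), IsChristoffel nabla x₀ U Γ := by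
  let b := Module.finBasis ℝ E
  let e := chartAt E x₀
  have he : e ∈ IsManifold.maximalAtlas 𝓘(ℝ, E) ∞ M := IsManifold.chart_mem_maximalAtlas x₀
  let β : Fin (Module.finrank ℝ E) → E →L[ℝ] ℝ := fun i ↦ (b.coord i).toContinuousLinearMap
  obtain ⟨Z, hZ, hZb⟩ := exists_frame x₀ b
  obtain ⟨U, hUsub, hUo, hxU⟩ := mem_nhds_iff.1 (Filter.inter_mem hZb
    (e.open_source.mem_nhds (mem_chart_source E x₀)))
  have hZd : ∀ i y, MDiffAt (T% (Z i)) y := fun i y ↦ (hZ i y).mdifferentiableAt (by simp)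
  have hcov : ∀ i j, CMDiff ∞ (T% fun z ↦ nabla (Z i) z (Z j z)) := fun i j ↦ by
    have h1 := hsmooth.contMDiff.contMDiff (σ := Z i) (hZ i).contMDiffOn
    exact ContMDiff.clm_bundle_apply (contMDiffOn_univ.1 h1) (hZ j)
  let G : Fin (Module.finrank ℝ E) → Fin (Module.finrank ℝ E) → M → E := fun i j z ↦
    mvfderiv 𝓘(ℝ, E) e z (nabla (Z i) z (Z j z))
  have hZU : ∀ y ∈ U, ∀ X : TangentSpace 𝓘(ℝ, E) y,
      X = ∑ i, β i (mvfderiv 𝓘(ℝ, E) e y X) • Z i y := fun y hy X ↦ by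
    apply (chartEquiv he (hUsub hy).2).injective
    rw [map_sum, chartEquiv_apply]
    conv_lhs => rw [← b.sum_repr (mvfderiv 𝓘(ℝ, E) e y X)]
    refine Finset.sum_congr rfl fun i _ ↦ ?_
    rw [map_smul, chartEquiv_apply, (hUsub hy).1 i]
    rfl
  -- The Christoffel symbols are the chart components of `∇_{Z j} Z i`: the first argument is the
  -- direction (index `j`), the second the differentiated field (index `i`).
  refine ⟨U, fun p ↦ ∑ i, ∑ j, (β j).smulRight ((β i).smulRight (G i j (e.symm p))),
    ⟨hUo, hxU, fun y hy ↦ (hUsub hy).2, fun y hy ↦ ?_, fun y hy X hX v ↦ ?_⟩⟩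
  · refine ContDiffAt.sum fun i _ ↦ ContDiffAt.sum fun j _ ↦ ?_
    have h1 : ContDiffAt ℝ ∞ (G i j ∘ e.symm) (e y) := contDiffAt_comp_chart_symm he (hUsub hy).2
      (contMDiffAt_chart_section (hUsub hy).2 (hcov i j y))
    exact contDiffAt_const.smulRight (contDiffAt_const.smulRight h1)
  · let c : Fin (Module.finrank ℝ E) → M → ℝ := fun i z ↦ β i (mvfderiv 𝓘(ℝ, E) e z (X z))
    have hXs := mdifferentiableAt_chart_section (hUsub hy).2 hX
    have hc : ∀ i, MDiffAt (c i) y := fun i ↦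
      (β i).differentiableAt.mdifferentiableAt.comp y hXs
    have hdc : ∀ i, mvfderiv 𝓘(ℝ, E) (c i) y v =
        β i (mvfderiv 𝓘(ℝ, E) (fun z ↦ mvfderiv 𝓘(ℝ, E) e z (X z)) y v) := fun i ↦ by
      have := mfderiv_comp_apply y (β i).differentiableAt.mdifferentiableAt hXs v
      rw [mfderiv_eq_fderiv, (β i).fderiv] at this
      exact this
    -- On `U` the field `X` is the combination of the frame with coefficients `c i`. Locality of the
    -- connection and the Leibniz rule then give the flat term, from the derivatives of the `c i`,
    -- and the Christoffel term.
    have hXeq : nabla X y = nabla (∑ i, c i • Z i) y := by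
      refine nabla.isCovariantDerivativeOnUniv.congr_of_eventuallyEq hX ?_ Filter.univ_mem ?_
      · have := MDifferentiableAt.sum_section (𝕜 := ℝ) (I := 𝓘(ℝ, E)) (s := Finset.univ) (x₀ := y)
          (t := fun i ↦ c i • Z i) fun i _ ↦ (hc i).smul_section (hZd i y)
        convert! this using 3
        simp
      · filter_upwards [hUo.mem_nhds hy] with z hz
        rw [Finset.sum_apply]
        exact hZU z hz (X z)
    rw [hXeq, nabla_sum_smul nabla _ hc fun i ↦ hZd i y, map_sum]
    have hb : ∀ w : E, w = ∑ i, β i w • b i := fun w ↦ (b.sum_repr w).symm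
    rw [hb (mvfderiv 𝓘(ℝ, E) (fun z ↦ mvfderiv 𝓘(ℝ, E) (chartAt E x₀) z (X z)) y v)]
    have hG : (∑ i, ∑ j, (β j).smulRight ((β i).smulRight (G i j (e.symm (e y)))))
        (mvfderiv 𝓘(ℝ, E) e y v) (mvfderiv 𝓘(ℝ, E) e y (X y)) =
        ∑ i, c i y • mvfderiv 𝓘(ℝ, E) e y (nabla (Z i) y v) := by
      rw [_root_.sum_apply, _root_.sum_apply]
      refine Finset.sum_congr rfl fun i _ ↦ ?_
      rw [_root_.sum_apply, _root_.sum_apply]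
      conv_rhs => rw [hZU y hy v, map_sum, map_sum, Finset.smul_sum]
      refine Finset.sum_congr rfl fun j _ ↦ ?_
      simp only [G, e.left_inv (hUsub hy).2, c, map_smul]
      simp only [ContinuousLinearMap.smulRight_apply, _root_.smul_apply]
      rw [smul_comm]
    rw [hG, ← Finset.sum_add_distrib]
    refine Finset.sum_congr rfl fun i _ ↦ ?_
    rw [map_add, map_smul, map_smul, (hUsub hy).1 i, hdc, add_comm]

end Connection

end

section

/-! ### Iterated covariant differentials in coordinates -/

section LocalCovDiff

variable {E : Type*} [NormedAddCommGroup E] [NormedSpace ℝ E]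

variable (E) in
/-- The endomorphism `B` acting as a derivation on multilinear maps. -/
def slotAction (r : ℕ) : (E →L[ℝ] E) →L[ℝ] (E [×r]→L[ℝ] ℂ) →L[ℝ] (E [×r]→L[ℝ] ℂ) :=
  -- The derivative of `(A_k) ↦ τ ∘ (A_k)` at the identities, in the direction `(B, …, B)`; this
  -- form gives continuity and bilinearity at once.
  (ContinuousMultilinearMap.compContinuousLinearMapContinuousMultilinear ℝ
    (fun _ : Fin r ↦ E) (fun _ ↦ E) ℂ).linearDeriv (fun _ ↦ ContinuousLinearMap.id ℝ E) ∘L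
    ContinuousLinearMap.pi fun _ ↦ ContinuousLinearMap.id ℝ (E →L[ℝ] E)

theorem slotAction_apply {r : ℕ} (B : E →L[ℝ] E) (τ : E [×r]→L[ℝ] ℂ) (v : Fin r → E) :
    slotAction E r B τ v = ∑ k, τ (Function.update v k (B (v k))) := by
  rw [slotAction, ContinuousLinearMap.comp_apply, ContinuousMultilinearMap.linearDeriv_apply,
    _root_.sum_apply, _root_.sum_apply]
  refine Finset.sum_congr rfl fun k _ ↦ ?_
  change τ _ = _
  congr 1
  ext1 j
  by_cases h : j = k
  · subst h; simp
  · simp [h]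

variable (E) in
/-- Uncurrying of multilinear maps, as a continuous linear map. -/
def curryLeftCLM (r : ℕ) : (E →L[ℝ] E [×r]→L[ℝ] ℂ) →L[ℝ] (E [×(r + 1)]→L[ℝ] ℂ) :=
  (continuousMultilinearCurryLeftEquiv ℝ
    (fun _ : Fin (r + 1) ↦ E) ℂ).symm.toContinuousLinearEquiv.toContinuousLinearMap

/-- The iterated covariant differential in coordinates, for given Christoffel symbols. -/
def localCovDiff (Γ : E → E →L[ℝ] E →L[ℝ] E) (F : E → ℂ) : (r : ℕ) → E → E [×r]→L[ℝ] ℂ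
  | 0 => (continuousMultilinearCurryFin0 ℝ E ℂ).symm ∘ F
  | r + 1 => fun p ↦ curryLeftCLM E r
      (fderiv ℝ (localCovDiff Γ F r) p - (slotAction E r).flip (localCovDiff Γ F r p) ∘L Γ p)

variable {Γ : E → E →L[ℝ] E →L[ℝ] E} {F G : E → ℂ} {p : E}

theorem localCovDiff_succ_apply (Γ : E → E →L[ℝ] E →L[ℝ] E) (F : E → ℂ) (r : ℕ) (p : E)
    (v : Fin (r + 1) → E) :
    localCovDiff Γ F (r + 1) p v = fderiv ℝ (localCovDiff Γ F r) p (v 0) (Fin.tail v) -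
      ∑ k, localCovDiff Γ F r p
        (Function.update (Fin.tail v) k (Γ p (v 0) (v k.succ))) := by
  change (fderiv ℝ (localCovDiff Γ F r) p -
    (slotAction E r).flip (localCovDiff Γ F r p) ∘L Γ p) (v 0) (Fin.tail v) = _
  rw [_root_.sub_apply, _root_.sub_apply, ContinuousLinearMap.comp_apply,
    ContinuousLinearMap.flip_apply,
    slotAction_apply]
  rfl

/-- With `B = slotAction E r` this controls the Christoffel correction: it contains `τ`
undifferentiated, so no order of vanishing is lost. -/
theorem VanishesToOrder.flip_comp {D V W : Type*} [NormedAddCommGroup D] [NormedSpace ℝ D]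
    [NormedAddCommGroup V] [NormedSpace ℝ V] [NormedAddCommGroup W] [NormedSpace ℝ W] {k : ℕ}
    {τ : E → W} {p : E} (hτ : VanishesToOrder k τ p) (B : V →L[ℝ] W →L[ℝ] W)
    {Γ : E → D →L[ℝ] V} (hΓ : ContDiffAt ℝ ∞ Γ p) :
    VanishesToOrder k (fun z ↦ B.flip (τ z) ∘L Γ z) p :=
  hτ.bilinear (ContinuousLinearMap.compL ℝ D V W ∘L B.flip) (.of_contDiffAt hΓ)

theorem contDiffAt_localCovDiff (hΓ : ContDiffAt ℝ ∞ Γ p) (hF : ContDiffAt ℝ ∞ F p) (r : ℕ) :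
    ContDiffAt ℝ ∞ (localCovDiff Γ F r) p := by
  induction r with
  | zero =>
    exact (continuousMultilinearCurryFin0 ℝ E ℂ).symm.contDiff.contDiffAt.comp p hF
  | succ r ih =>
    have h : ContDiffAt ℝ ∞ (fun q ↦ fderiv ℝ (localCovDiff Γ F r) q -
        (slotAction E r).flip (localCovDiff Γ F r q) ∘L Γ q) p :=
      (ih.fderiv_right (by simp)).sub
        ((VanishesToOrder.of_contDiffAt ih).flip_comp (slotAction E r) hΓ).1
    exact ((VanishesToOrder.of_contDiffAt h).clm_comp (curryLeftCLM E r)).1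

/-- The identity is proved on an open set, since the induction step differentiates it. -/
theorem localCovDiff_add_smul {W : Set E} (hW : IsOpen W) (hΓ : ∀ p ∈ W, ContDiffAt ℝ ∞ Γ p)
    (hF : ∀ p ∈ W, ContDiffAt ℝ ∞ F p) (hG : ∀ p ∈ W, ContDiffAt ℝ ∞ G p) (c : ℂ) (r : ℕ) :
    ∀ p ∈ W, localCovDiff Γ (F + c • G) r p = localCovDiff Γ F r p + c • localCovDiff Γ G r p := by
  induction r with
  | zero => intro p _; rfl
  | succ r ih =>
    intro p hp
    have h1 : localCovDiff Γ (F + c • G) r =ᶠ[nhds p]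
        localCovDiff Γ F r + c • localCovDiff Γ G r := by
      filter_upwards [hW.mem_nhds hp] with q hq using ih q hq
    have h2 : DifferentiableAt ℝ (localCovDiff Γ F r) p :=
      (contDiffAt_localCovDiff (hΓ p hp) (hF p hp) r).differentiableAt (by simp)
    have h3 : DifferentiableAt ℝ (localCovDiff Γ G r) p :=
      (contDiffAt_localCovDiff (hΓ p hp) (hG p hp) r).differentiableAt (by simp)
    ext v
    rw [_root_.add_apply, _root_.smul_apply]
    simp only [localCovDiff_succ_apply]
    rw [h1.fderiv_eq, fderiv_add h2 (h3.const_smul c), fderiv_const_smul h3 c, ih p hp]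
    simp only [_root_.add_apply, _root_.smul_apply, Finset.sum_add_distrib, smul_eq_mul,
      ← Finset.mul_sum]
    ring

/-- Each covariant differentiation costs one order, through its derivative term; the correction term
costs none. -/
theorem vanishesToOrder_localCovDiff (hΓ : ContDiffAt ℝ ∞ Γ p) (r : ℕ) {l : ℕ}
    (hF : VanishesToOrder (r + l) F p) : VanishesToOrder l (localCovDiff Γ F r) p := by
  induction r generalizing l with
  | zero =>
    rw [zero_add] at hF
    exact hF.clm_comp
      (continuousMultilinearCurryFin0 ℝ E ℂ).symm.toContinuousLinearEquiv.toContinuousLinearMap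
  | succ r ih =>
    have h1 : VanishesToOrder (l + 1) (localCovDiff Γ F r) p :=
      ih (by rwa [show r + (l + 1) = r + 1 + l by ring])
    have h2 := h1.flip_comp (slotAction E r) hΓ
    exact (h1.fderiv.sub (h2.mono (Nat.le_succ l))).clm_comp
      (curryLeftCLM E r)

/-- The covariant differential has the same leading term as the ordinary one. -/
theorem vanishesToOrder_localCovDiff_sub (hΓ : ContDiffAt ℝ ∞ Γ p) (r : ℕ) {l : ℕ}
    (hF : VanishesToOrder (r + l) F p) :
    VanishesToOrder (l + 1) (localCovDiff Γ F r - iteratedFDeriv ℝ r F) p := by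
  induction r generalizing l with
  | zero =>
    have : localCovDiff Γ F 0 - iteratedFDeriv ℝ 0 F = 0 := by
      rw [iteratedFDeriv_zero_eq_comp, localCovDiff, sub_self]
    rw [this]
    exact .zero
  | succ r ih =>
    have hF' : VanishesToOrder (r + (l + 1)) F p := by
      rwa [show r + (l + 1) = r + 1 + l by ring]
    -- The new discrepancy is the derivative of the old one minus the Christoffel correction. The
    -- old one vanishes to order `l + 2` by induction, and the correction to order `l + 1` because
    -- `localCovDiff Γ F r` does.
    have h1 : VanishesToOrder (l + 1) (fderiv ℝ (localCovDiff Γ F r - iteratedFDeriv ℝ r F)) p :=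
      (ih hF').fderiv
    have h2 := (vanishesToOrder_localCovDiff hΓ r hF').flip_comp (slotAction E r) hΓ
    have h3 := (h1.sub h2).clm_comp (curryLeftCLM E r)
    refine h3.congr ?_
    have hd1 : ∀ᶠ q in nhds p, DifferentiableAt ℝ (localCovDiff Γ F r) q :=
      (((contDiffAt_localCovDiff hΓ hF.1 r).of_le (m := 1) (by simp)).eventually (by simp)).mono
        fun q hq ↦ hq.differentiableAt (by simp)
    have hd2 : ∀ᶠ q in nhds p, DifferentiableAt ℝ (iteratedFDeriv ℝ r F) q := by
      have : ContDiffAt ℝ ((r + 1 : ℕ) : WithTop ℕ∞) F p := hF.1.of_le (mod_cast le_top)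
      exact (this.eventually (by simp)).mono fun q hq ↦
        hq.differentiableAt_iteratedFDeriv (mod_cast Nat.lt_succ_self r)
    filter_upwards [hd1, hd2] with q hq1 hq2
    rw [Pi.sub_apply, Pi.sub_apply, fderiv_sub hq1 hq2, iteratedFDeriv_succ_eq_comp_left]
    exact (congrArg (curryLeftCLM E r) (sub_right_comm _ _ _)).trans
      (map_sub (curryLeftCLM E r) _ _)

end LocalCovDiff

section IterCovDiff

open scoped Bundle

variable {E : Type*} [NormedAddCommGroup E] [NormedSpace ℝ E]
  {M : Type*} [TopologicalSpace M] [ChartedSpace E M] [IsManifold 𝓘(ℝ, E) ∞ M]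

variable {nabla : CovariantDerivative 𝓘(ℝ, E) E (TangentSpace 𝓘(ℝ, E) : M → Type _)}
  {x₀ : M} {U : Set M} {Γ : E → E →L[ℝ] E →L[ℝ] E}

/-- The product rule for `T(X_1, …, X_r)` produces derivatives of the chart components of the
extensions `X_k`. They cancel against the flat parts of the `∇ X_k`, so only the Christoffel terms
remain and the choice of extensions does not matter. -/
theorem IsChristoffel.iterCovDiff_eq (h : IsChristoffel nabla x₀ U Γ) (f : SmoothFun E M) (r : ℕ) :
    ∀ y ∈ U, ∀ v, iterCovDiff nabla f r y v =
      localCovDiff Γ ((f : M → ℂ) ∘ (chartAt E x₀).symm) r (chartAt E x₀ y)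
        fun k ↦ mvfderiv 𝓘(ℝ, E) (chartAt E x₀) y (v k) := by
  have he : chartAt E x₀ ∈ IsManifold.maximalAtlas 𝓘(ℝ, E) ∞ M :=
    IsManifold.chart_mem_maximalAtlas x₀
  set e := chartAt E x₀ with e_def
  induction r with
  | zero =>
    intro y hy v
    have : (f : M → ℂ) y = (f : M → ℂ) (e.symm (e y)) := by rw [e.left_inv (h.subset hy)]
    exact this
  | succ r ih =>
    intro y hy v
    have hys := h.subset hy
    set τ := localCovDiff Γ ((f : M → ℂ) ∘ e.symm) r
    let X : Fin r → (z : M) → TangentSpace 𝓘(ℝ, E) z := fun k ↦ FiberBundle.extend E (v k.succ)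
    have hX : ∀ k, MDiffAt (T% (X k)) y := fun k ↦
      FiberBundle.mdifferentiableAt_extend 𝓘(ℝ, E) E (v k.succ)
    let S : Fin r → M → E := fun k z ↦ mvfderiv 𝓘(ℝ, E) e z (X k z)
    have hS : ∀ k, MDifferentiableAt 𝓘(ℝ, E) 𝓘(ℝ, E) (S k) y := fun k ↦
      mdifferentiableAt_chart_section hys (hX k)
    have hXy : ∀ k, X k y = v k.succ := fun k ↦ FiberBundle.extend_apply_self E (v k.succ)
    have hτ : DifferentiableAt ℝ τ (e y) :=
      (contDiffAt_localCovDiff (h.contDiffAt y hy)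
        (contDiffAt_coe_comp_symm he hys f) r).differentiableAt (by simp)
    let w : E := mvfderiv 𝓘(ℝ, E) e y (v 0)
    have hev : (fun z ↦ iterCovDiff nabla f r z fun k ↦ X k z) =ᶠ[nhds y]
        (fun q ↦ τ q fun k ↦ (S k ∘ e.symm) q) ∘ e := by
      filter_upwards [h.isOpen.mem_nhds hy] with z hz
      rw [ih z hz]
      simp only [Function.comp_apply, e.left_inv (h.subset hz)]
      rfl
    have hder := hτ.hasFDerivAt.continuousMultilinearMap_apply fun k ↦
      (differentiableAt_comp_chart_symm he hys (hS k)).hasFDerivAt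
    have hSy : ∀ k, (S k ∘ e.symm) (e y) = mvfderiv 𝓘(ℝ, E) e y (v k.succ) := fun k ↦ by
      change S k (e.symm (e y)) = _
      rw [e.left_inv hys, ← hXy]
    have h1 : mvfderiv 𝓘(ℝ, E) (fun z ↦ iterCovDiff nabla f r z fun k ↦ X k z) y (v 0) =
        fderiv ℝ τ (e y) w (fun k ↦ mvfderiv 𝓘(ℝ, E) e y (v k.succ)) +
          ∑ k, τ (e y) (Function.update (fun j ↦ mvfderiv 𝓘(ℝ, E) e y (v j.succ)) k
            (mvfderiv 𝓘(ℝ, E) (S k) y (v 0))) := by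
      rw [mvfderiv_congr hev, mvfderiv_comp_chart he hys hder.differentiableAt, hder.fderiv]
      simp only [hSy, _root_.add_apply, _root_.sum_apply, ContinuousLinearMap.comp_apply]
      congr 1
      refine Finset.sum_congr rfl fun k _ ↦ ?_
      rw [mvfderiv_eq_fderiv_chart he hys (hS k)]
      rfl
    have h2 : ∀ k, iterCovDiff nabla f r y (Function.update (fun j ↦ v j.succ) k
        (nabla (X k) y (v 0))) =
        τ (e y) (Function.update (fun j ↦ mvfderiv 𝓘(ℝ, E) e y (v j.succ)) k
          (mvfderiv 𝓘(ℝ, E) (S k) y (v 0))) +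
        τ (e y) (Function.update (fun j ↦ mvfderiv 𝓘(ℝ, E) e y (v j.succ)) k
          (Γ (e y) w (mvfderiv 𝓘(ℝ, E) e y (v k.succ)))) := fun k ↦ by
      rw [ih y hy, ← ContinuousMultilinearMap.map_update_add]
      congr 1
      ext1 j
      by_cases hj : j = k
      · subst hj
        rw [Function.update_self, Function.update_self, h.nabla_eq y hy (X j) (hX j), hXy]
      · simp [hj]
    rw [iterCovDiff, covDiff]
    change mvfderiv 𝓘(ℝ, E) (fun z ↦ iterCovDiff nabla f r z fun k ↦ X k z) y (v 0) -
      ∑ k, iterCovDiff nabla f r y (Function.update (fun j ↦ v j.succ) k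
        (nabla (X k) y (v 0))) = _
    rw [h1, Finset.sum_congr rfl fun k _ ↦ h2 k, Finset.sum_add_distrib, localCovDiff_succ_apply]
    simp only [τ, w]
    rw [add_comm, add_sub_add_left_eq_sub]
    rfl

end IterCovDiff

end

section

variable {E : Type*} [NormedAddCommGroup E] [NormedSpace ℝ E]
  {M : Type*} [TopologicalSpace M] [ChartedSpace E M] [IsManifold 𝓘(ℝ, E) ∞ M]

/-! ### Quantization of homogeneous tensor fields -/

section Quantized

variable {nabla : CovariantDerivative 𝓘(ℝ, E) E (TangentSpace 𝓘(ℝ, E) : M → Type _)}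
  {x₀ : M} {U : Set M} {Γ : E → E →L[ℝ] E →L[ℝ] E} {r : ℕ}

theorem IsChristoffel.iterCovDiff_add_smul (h : IsChristoffel nabla x₀ U Γ) (f g : SmoothFun E M)
    (c : ℂ) : iterCovDiff nabla ((f + c • g : SmoothFun E M) : M → ℂ) r x₀ =
      iterCovDiff nabla f r x₀ + c • iterCovDiff nabla g r x₀ := by
  have he : chartAt E x₀ ∈ IsManifold.maximalAtlas 𝓘(ℝ, E) ∞ M :=
    IsManifold.chart_mem_maximalAtlas x₀
  set e := chartAt E x₀
  have hW : IsOpen (e.target ∩ e.symm ⁻¹' U) := e.isOpen_inter_preimage_symm h.isOpen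
  have hf : ∀ f : SmoothFun E M, ∀ p ∈ e.target ∩ e.symm ⁻¹' U,
      ContDiffAt ℝ ∞ ((f : M → ℂ) ∘ e.symm) p := fun f p hp ↦ by
    have := contDiffAt_coe_comp_symm he (e.map_target hp.1) f
    rwa [e.right_inv hp.1] at this
  have hx := h.subset h.mem
  have key := localCovDiff_add_smul hW (fun p hp ↦ by
    have := h.contDiffAt _ hp.2
    rwa [e.right_inv hp.1] at this) (hf f) (hf g) c r (e x₀)
    ⟨e.map_source hx, by simpa [e.left_inv hx] using h.mem⟩
  ext v
  rw [Pi.add_apply, Pi.smul_apply]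
  simp only [h.iterCovDiff_eq _ r x₀ h.mem]
  exact congrArg (fun m ↦ m fun k ↦ mvfderiv 𝓘(ℝ, E) e x₀ (v k)) key

theorem IsChristoffel.iterCovDiff_eq_zero (h : IsChristoffel nabla x₀ U Γ) {f : SmoothFun E M}
    (hf : f ∈ idealAt E x₀ ^ (r + 1)) : iterCovDiff nabla f r x₀ = 0 := by
  ext v
  rw [h.iterCovDiff_eq _ r x₀ h.mem, (vanishesToOrder_localCovDiff (h.contDiffAt x₀ h.mem) r
    (vanishesToOrder_of_mem_idealAt_pow (IsManifold.chart_mem_maximalAtlas x₀)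
      (h.subset h.mem) hf)).eq_zero]
  rfl

theorem IsChristoffel.iterCovDiff_eq_chartDiff (h : IsChristoffel nabla x₀ U Γ) {f : SmoothFun E M}
    (hf : f ∈ idealAt E x₀ ^ r) :
    iterCovDiff nabla f r x₀ = chartDiff (chartAt E x₀) r f x₀ := by
  ext v
  -- For `l = 0` the discrepancy vanishes to order `1`, that is, its value at the point is zero.
  have := (vanishesToOrder_localCovDiff_sub (l := 0) (h.contDiffAt x₀ h.mem) r
    (vanishesToOrder_of_mem_idealAt_pow (IsManifold.chart_mem_maximalAtlas x₀)
      (h.subset h.mem) hf)).eq_zero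
  rw [h.iterCovDiff_eq _ r x₀ h.mem, chartDiff, sub_eq_zero.1 this]

variable [FiniteDimensional ℝ E]

theorem quantized_eq (nabla : CovariantDerivative 𝓘(ℝ, E) E (TangentSpace 𝓘(ℝ, E) : M → Type _))
    (hbar : ℝ) (Φ : SymTensorField E M r) (f : SmoothFun E M) (x : M) :
    quantized nabla hbar Φ f x =
      (-Complex.I * hbar) ^ r * contract (Φ.1 x) (iterCovDiff nabla f r x) := by
  rw [quantized, contract_symmetrize (Φ.2.1 x)]

/-- The basis built into `contract` is not adapted to the chart at `x₀`. In the coordinate basis of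
that chart both factors of each summand are smooth in `y`, which yields smoothness of `Φ̂ f`. -/
theorem IsChristoffel.quantized_eq_sum (h : IsChristoffel nabla x₀ U Γ) (hbar : ℝ)
    (Φ : SymTensorField E M r) (f : SmoothFun E M) {y : M} (hy : y ∈ U) :
    quantized nabla hbar Φ f y = (-Complex.I * hbar) ^ r *
      ∑ i : Fin r → Fin (Module.finrank ℝ E),
        Φ.1 y (fun k ↦ ((Module.finBasis ℝ E).coord (i k)).comp
          (mvfderiv 𝓘(ℝ, E) (chartAt E x₀) y).toLinearMap) *
        localCovDiff Γ ((f : M → ℂ) ∘ (chartAt E x₀).symm) r (chartAt E x₀ y)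
          fun k ↦ Module.finBasis ℝ E (i k) := by
  let A := chartEquiv (IsManifold.chart_mem_maximalAtlas (I := 𝓘(ℝ, E)) (n := ∞) x₀) (h.subset hy)
  let η : MultilinearMap ℝ (fun _ : Fin r ↦ TangentSpace 𝓘(ℝ, E) y) ℂ :=
    (localCovDiff Γ ((f : M → ℂ) ∘ (chartAt E x₀).symm) r
      (chartAt E x₀ y)).toMultilinearMap.compLinearMap fun _ ↦ A.toLinearMap
  have hη : iterCovDiff nabla f r y = fun v ↦ η v := by
    ext v
    rw [h.iterCovDiff_eq f r y hy]
    rfl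
  rw [quantized_eq, hη, contract_eq_of_equiv _ η A (Module.finBasis ℝ E)]
  congr 1
  refine Finset.sum_congr rfl fun i _ ↦ ?_
  congr 1
  change localCovDiff Γ ((f : M → ℂ) ∘ (chartAt E x₀).symm) r (chartAt E x₀ y)
    (fun k ↦ A (A.symm (Module.finBasis ℝ E (i k)))) = _
  simp only [A.apply_symm_apply]

theorem IsChristoffel.contMDiffAt_quantized (h : IsChristoffel nabla x₀ U Γ) (hbar : ℝ)
    (Φ : SymTensorField E M r) (f : SmoothFun E M) :
    ContMDiffAt 𝓘(ℝ, E) 𝓘(ℝ, ℂ) ∞ (quantized nabla hbar Φ f) x₀ := by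
  have he : chartAt E x₀ ∈ IsManifold.maximalAtlas 𝓘(ℝ, E) ∞ M :=
    IsManifold.chart_mem_maximalAtlas x₀
  have hx := h.subset h.mem
  refine ContMDiffAt.congr_of_eventuallyEq (f := fun y ↦ (-Complex.I * hbar) ^ r *
      ∑ i : Fin r → Fin (Module.finrank ℝ E),
        Φ.1 y (fun k ↦ ((Module.finBasis ℝ E).coord (i k)).comp
          (mvfderiv 𝓘(ℝ, E) (chartAt E x₀) y).toLinearMap) *
        localCovDiff Γ ((f : M → ℂ) ∘ (chartAt E x₀).symm) r (chartAt E x₀ y)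
          fun k ↦ Module.finBasis ℝ E (i k))
    (contMDiffAt_mul contMDiffAt_const (ContMDiffAt.sum fun i _ ↦ contMDiffAt_mul ?_ ?_))
    (Filter.eventually_of_mem (h.isOpen.mem_nhds h.mem) fun y hy ↦
      h.quantized_eq_sum hbar Φ f hy)
  · exact (Φ.2.2 _ he _).contMDiffAt ((chartAt E x₀).open_source.mem_nhds hx)
  · have h1 := contDiffAt_localCovDiff (h.contDiffAt x₀ h.mem)
      (contDiffAt_coe_comp_symm he hx f) r
    have h2 : ContDiffAt ℝ ∞ (fun p ↦ localCovDiff Γ ((f : M → ℂ) ∘ (chartAt E x₀).symm) r p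
        fun k ↦ Module.finBasis ℝ E (i k)) (chartAt E x₀ x₀) :=
      (ContinuousMultilinearMap.apply ℝ (fun _ : Fin r ↦ E) ℂ
        fun k ↦ Module.finBasis ℝ E (i k)).contDiff.contDiffAt.comp _ h1
    exact contMDiffAt_comp_chart he hx h2

variable [T2Space M]

/-- The quantized operators of the homogeneous tensor fields of order `r`. -/
def quantizedHom {nabla : CovariantDerivative 𝓘(ℝ, E) E (TangentSpace 𝓘(ℝ, E) : M → Type _)}
    (hsmooth : CovariantDerivative.ContMDiffCovariantDerivative nabla ∞) (hbar : ℝ) (r : ℕ) :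
    SymTensorField E M r →ₗ[ℂ] SmoothFun E M →ₗ[ℂ] SmoothFun E M :=
  LinearMap.mk₂ ℂ
    (fun Φ f ↦ ⟨quantized nabla hbar Φ f, fun x ↦ by
      obtain ⟨U, Γ, h⟩ := exists_christoffel hsmooth x
      exact h.contMDiffAt_quantized hbar Φ f⟩)
    (fun Φ Ψ f ↦ by
      ext x
      change quantized nabla hbar (Φ + Ψ) f x =
        quantized nabla hbar Φ f x + quantized nabla hbar Ψ f x
      simp only [quantized_eq]
      rw [← mul_add, ← contract_add_left]
      rfl)
    (fun c Φ f ↦ by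
      ext x
      change quantized nabla hbar (c • Φ) f x = c * quantized nabla hbar Φ f x
      simp only [quantized_eq]
      rw [show (c • Φ : SymTensorField E M r).1 x = c • Φ.1 x from rfl, contract_smul_left,
        mul_left_comm])
    (fun Φ f g ↦ by
      ext x
      obtain ⟨U, Γ, h⟩ := exists_christoffel hsmooth x
      change quantized nabla hbar Φ (f + g) x =
        quantized nabla hbar Φ f x + quantized nabla hbar Φ g x
      have := h.iterCovDiff_add_smul (r := r) f g 1
      rw [one_smul, one_smul] at this
      simp only [quantized_eq]
      rw [this, contract_add_right, mul_add])
    (fun c Φ f ↦ by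
      ext x
      obtain ⟨U, Γ, h⟩ := exists_christoffel hsmooth x
      change quantized nabla hbar Φ (c • f) x = c * quantized nabla hbar Φ f x
      have := h.iterCovDiff_add_smul (r := r) 0 f c
      rw [zero_add, h.iterCovDiff_eq_zero (Ideal.zero_mem _), zero_add] at this
      simp only [quantized_eq]
      rw [this, contract_smul_right, mul_left_comm])

variable (hsmooth : CovariantDerivative.ContMDiffCovariantDerivative nabla ∞) (hbar : ℝ)

theorem quantizedHom_apply (Φ : SymTensorField E M r) (f : SmoothFun E M) :
    (quantizedHom hsmooth hbar r Φ f : M → ℂ) = quantized nabla hbar Φ f :=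
  rfl

theorem hasOrder_quantizedHom (Φ : SymTensorField E M r) :
    HasOrder r (quantizedHom hsmooth hbar r Φ) := by
  intro x f hf
  obtain ⟨U, Γ, h⟩ := exists_christoffel hsmooth x
  rw [mem_idealAt, quantizedHom_apply, quantized_eq, h.iterCovDiff_eq_zero hf, contract_zero_right,
    mul_zero]

/-- On `𝔪_x ^ r` the iterated covariant differential at `x` is the ordinary `r`-th differential, so
the defining formula of `Φ̂` already has the shape of a symbol. -/
theorem isSymbol_quantizedHom (Φ : SymTensorField E M r) :
    IsSymbol r (quantizedHom hsmooth hbar r Φ) ((-Complex.I * hbar) ^ r • Φ) := by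
  refine isSymbol_of_prod (hasOrder_quantizedHom hsmooth hbar Φ) fun x f hf ↦ ?_
  obtain ⟨U, Γ, h⟩ := exists_christoffel hsmooth x
  rw [quantizedHom_apply, quantized_eq, h.iterCovDiff_eq_chartDiff (prod_mem_idealAt_pow hf),
    contract_chartDiff_prod (IsManifold.chart_mem_maximalAtlas x) (mem_chart_source E x) Φ hf]
  change _ = _ * contract ((-Complex.I * hbar) ^ r • Φ.1 x) _
  rw [contract_smul_left, mul_left_comm]

end Quantized

end

section

variable {E : Type*} [NormedAddCommGroup E] [NormedSpace ℝ E]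
  {M : Type*} [TopologicalSpace M] [ChartedSpace E M]

/-! ### Principal symbols and lower order operators -/

section Symbols

variable [FiniteDimensional ℝ E] {r : ℕ}
  {P Q : SmoothFun E M →ₗ[ℂ] SmoothFun E M} {σ τ : SymTensorField E M r}

theorem IsSymbol.add (hP : IsSymbol r P σ) (hQ : IsSymbol r Q τ) : IsSymbol r (P + Q) (σ + τ) := by
  refine ⟨fun x f hf ↦ (idealAt E x).add_mem (hP.1 x f hf) (hQ.1 x f hf),
    fun x f hf e he hx ↦ ?_⟩
  change (P f : M → ℂ) x + (Q f : M → ℂ) x = contract (σ.1 x + τ.1 x) _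
  rw [contract_add_left, hP.2 x f hf e he hx, hQ.2 x f hf e he hx]

theorem contract_neg_left {x : M} (Φ : ContraTensor E r x) (η : CoTensor E r x) :
    contract (-Φ) η = -contract Φ η := by
  rw [← neg_one_smul ℂ Φ, contract_smul_left, neg_one_mul]

theorem IsSymbol.sub (hP : IsSymbol r P σ) (hQ : IsSymbol r Q τ) : IsSymbol r (P - Q) (σ - τ) := by
  refine ⟨fun x f hf ↦ (idealAt E x).sub_mem (hP.1 x f hf) (hQ.1 x f hf),
    fun x f hf e he hx ↦ ?_⟩
  change (P f : M → ℂ) x - (Q f : M → ℂ) x = contract (σ.1 x - τ.1 x) _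
  rw [sub_eq_add_neg (σ.1 x), contract_add_left, contract_neg_left, hP.2 x f hf e he hx,
    hQ.2 x f hf e he hx, sub_eq_add_neg]

theorem contract_zero_left {x : M} (η : CoTensor E r x) :
    contract (0 : ContraTensor E r x) η = 0 := by
  rw [← zero_smul ℂ (0 : ContraTensor E r x), contract_smul_left, zero_mul]

theorem HasOrder.isSymbol_succ_zero (hP : HasOrder r P) : IsSymbol (r + 1) P 0 :=
  ⟨hP.mono r.le_succ, fun x f hf _ _ _ ↦ (mem_idealAt.1 (hP x f hf)).trans
    (contract_zero_left _).symm⟩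

/-- Having order `r` and having zero symbol of order `r + 1` both say that `P f` vanishes at `x` for
`f ∈ 𝔪_x ^ (r + 1)`. This drives the descent on the order. -/
theorem IsSymbol.hasOrder (hP : IsSymbol (r + 1) P 0) [IsManifold 𝓘(ℝ, E) ∞ M] : HasOrder r P :=
  fun x f hf ↦ mem_idealAt.2 ((hP.2 x f hf _ (IsManifold.chart_mem_maximalAtlas x)
    (mem_chart_source E x)).trans (contract_zero_left _))

/-- The end of the descent: `𝔪_x ^ 0` is the whole algebra. -/
theorem IsSymbol.eq_zero (hP : IsSymbol 0 P 0) [IsManifold 𝓘(ℝ, E) ∞ M] : P = 0 := by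
  ext f x
  exact (hP.2 x f (by simp) _ (IsManifold.chart_mem_maximalAtlas x)
    (mem_chart_source E x)).trans (contract_zero_left _)

end Symbols

/-! ### Quantization of inhomogeneous tensor fields -/

theorem eq_sum_lof {n : ℕ} {Φ : SymTensors E M} (hΦ : ∀ j, n < j → Φ j = 0) :
    Φ = ∑ j ∈ Finset.range (n + 1), DirectSum.lof ℂ ℕ (fun j ↦ SymTensorField E M j) j (Φ j) := by
  refine DFinsupp.ext fun k ↦ ?_
  rw [DFinsupp.finsetSum_apply]
  by_cases hk : k < n + 1
  · rw [Finset.sum_eq_single_of_mem k (Finset.mem_range.2 hk)]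
    · exact (DirectSum.lof_apply (M := fun j ↦ SymTensorField E M j) ℂ k (Φ k)).symm
    · exact fun j _ hj ↦ DFinsupp.single_eq_of_ne hj.symm
  · rw [hΦ k (by omega), Finset.sum_eq_zero fun j hj ↦ ?_]
    exact DFinsupp.single_eq_of_ne (by have := Finset.mem_range.1 hj; omega)

theorem exists_forall_eq_zero (Φ : SymTensors E M) : ∃ n, ∀ j, n < j → Φ j = 0 := by
  classical
  obtain ⟨n, hn⟩ := (DFinsupp.support Φ).bddAbove
  exact ⟨n, fun j hj ↦ by_contra fun h ↦
    hj.not_ge (hn (Finset.mem_coe.2 (DFinsupp.mem_support_iff.2 h)))⟩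

theorem pow_hbar_ne_zero {hbar : ℝ} (hhbar : hbar ≠ 0) (n : ℕ) : (-Complex.I * hbar) ^ n ≠ 0 :=
  pow_ne_zero _ (mul_ne_zero (neg_ne_zero.2 Complex.I_ne_zero) (Complex.ofReal_ne_zero.2 hhbar))

section Quantization

variable [FiniteDimensional ℝ E] [IsManifold 𝓘(ℝ, E) ∞ M] [T2Space M]
  {nabla : CovariantDerivative 𝓘(ℝ, E) E (TangentSpace 𝓘(ℝ, E) : M → Type _)}
  (hsmooth : CovariantDerivative.ContMDiffCovariantDerivative nabla ∞) (hbar : ℝ)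

/-- The quantization rule `Φ ↦ Φ̂` on the inhomogeneous symmetric tensor fields. -/
def quantization : SymTensors E M →ₗ[ℂ] DiffOp E M :=
  DirectSum.toModule ℂ ℕ _ fun r ↦ (quantizedHom hsmooth hbar r).codRestrict (DiffOp E M)
    fun Φ ↦ ⟨r, hasOrder_quantizedHom hsmooth hbar Φ⟩

theorem quantization_lof {r : ℕ} (Φ : SymTensorField E M r) :
    (quantization hsmooth hbar (DirectSum.lof ℂ ℕ (fun j ↦ SymTensorField E M j) r Φ)).1 =
      quantizedHom hsmooth hbar r Φ := by
  rw [quantization, DirectSum.toModule_lof]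
  rfl

theorem quantization_eq_sum {n : ℕ} {Φ : SymTensors E M} (hΦ : ∀ j, n < j → Φ j = 0) :
    quantization hsmooth hbar Φ = ∑ j ∈ Finset.range (n + 1), quantization hsmooth hbar
      (DirectSum.lof ℂ ℕ (fun j ↦ SymTensorField E M j) j (Φ j)) := by
  rw [← map_sum, ← eq_sum_lof hΦ]

/-- Terms of degree below `n` have order below `n` and contribute zero to the symbol of order `n`.
-/
theorem isSymbol_sum_quantizedHom (Φ : SymTensors E M) (n : ℕ) :
    IsSymbol n (∑ j ∈ Finset.range (n + 1), quantizedHom hsmooth hbar j (Φ j))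
      ((-Complex.I * hbar) ^ n • Φ n) := by
  induction n with
  | zero => simpa using isSymbol_quantizedHom hsmooth hbar (Φ 0)
  | succ n ih =>
    rw [Finset.sum_range_succ]
    simpa using ih.1.isSymbol_succ_zero.add (isSymbol_quantizedHom hsmooth hbar (Φ (n + 1)))

theorem isSymbol_quantization {n : ℕ} {Φ : SymTensors E M} (hΦ : ∀ j, n < j → Φ j = 0) :
    IsSymbol n (quantization hsmooth hbar Φ).1 ((-Complex.I * hbar) ^ n • Φ n) := by
  rw [quantization_eq_sum hsmooth hbar hΦ, AddSubmonoidClass.coe_finsetSum]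
  simp only [quantization_lof]
  exact isSymbol_sum_quantizedHom hsmooth hbar Φ n

variable {hbar}

/-- Downward induction on a bound for the degree of `Φ`. If `n + 1 > r` bounds it, the symbol of
order `n + 1` is both `(-iħ)^(n+1) Φ_(n+1)` and zero, so the bound drops to `n`. -/
theorem eq_zero_of_hasOrder (hhbar : hbar ≠ 0) {r : ℕ} {Φ : SymTensors E M}
    (h : HasOrder r (quantization hsmooth hbar Φ).1) : ∀ j, r < j → Φ j = 0 := by
  obtain ⟨n, hn⟩ := exists_forall_eq_zero Φ
  induction n with
  | zero => exact fun j hj ↦ hn j (by omega)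
  | succ n ih =>
    rcases le_or_gt (n + 1) r with hr | hr
    · exact fun j hj ↦ hn j (by omega)
    · refine ih fun j hj ↦ ?_
      rcases eq_or_lt_of_le (Nat.succ_le_of_lt hj) with rfl | hj
      · have := (isSymbol_quantization hsmooth hbar hn).unique
          (h.mono (Nat.le_of_lt_succ hr)).isSymbol_succ_zero
        exact (smul_eq_zero.1 this).resolve_left (pow_hbar_ne_zero hhbar _)
      · exact hn j hj

theorem injective_quantization (hhbar : hbar ≠ 0) :
    Function.Injective (quantization (E := E) (M := M) hsmooth hbar) := by
  refine (injective_iff_map_eq_zero _).2 fun Φ hΦ ↦ ?_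
  -- Order `0` eliminates all components of positive degree; `Φ_0` is then killed by the zero symbol
  -- of order `0`.
  have h0 : HasOrder 0 (quantization hsmooth hbar Φ).1 := by
    rw [hΦ]
    exact fun x _ _ ↦ (idealAt E x).zero_mem
  have hz := eq_zero_of_hasOrder hsmooth hhbar h0
  have hs := isSymbol_quantization hsmooth hbar hz
  rw [hΦ] at hs
  have h00 : IsSymbol 0 (0 : SmoothFun E M →ₗ[ℂ] SmoothFun E M) 0 :=
    ⟨fun x _ _ ↦ (idealAt E x).zero_mem, fun x _ _ _ _ _ ↦ (contract_zero_left _).symm⟩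
  have := (smul_eq_zero.1 (hs.unique h00)).resolve_left (pow_hbar_ne_zero hhbar _)
  refine DFinsupp.ext fun j ↦ ?_
  rcases j.eq_zero_or_pos with rfl | hj
  · exact this
  · exact hz j hj

/-- The rescaling by `(-iħ)^(-r)` makes the two leading symbols equal, so that they cancel. -/
theorem isSymbol_sub_quantizedHom (hhbar : hbar ≠ 0) {r : ℕ}
    {P : SmoothFun E M →ₗ[ℂ] SmoothFun E M} (hP : HasOrder r P) :
    IsSymbol r (P - quantizedHom hsmooth hbar r
      (((-Complex.I * hbar) ^ r)⁻¹ • symbol hP)) 0 := by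
  have := (isSymbol_symbol hP).sub (isSymbol_quantizedHom hsmooth hbar
    (((-Complex.I * hbar) ^ r)⁻¹ • symbol hP))
  rwa [smul_inv_smul₀ (pow_hbar_ne_zero hhbar r), sub_self] at this

/-- Induction on the order: once the leading part is subtracted, the remainder has lower order, or
is zero when `r = 0`. -/
theorem exists_quantization_eq (hhbar : hbar ≠ 0) {r : ℕ}
    {P : SmoothFun E M →ₗ[ℂ] SmoothFun E M} (hP : HasOrder r P) :
    ∃ Φ, (quantization hsmooth hbar Φ).1 = P := by
  induction r generalizing P with
  | zero =>
    refine ⟨DirectSum.lof ℂ ℕ (fun j ↦ SymTensorField E M j) 0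
      (((-Complex.I * hbar) ^ 0)⁻¹ • symbol hP), ?_⟩
    rw [quantization_lof]
    exact (sub_eq_zero.1 (isSymbol_sub_quantizedHom hsmooth hhbar hP).eq_zero).symm
  | succ r ih =>
    obtain ⟨Φ, hΦ⟩ := ih (isSymbol_sub_quantizedHom hsmooth hhbar hP).hasOrder
    refine ⟨Φ + DirectSum.lof ℂ ℕ (fun j ↦ SymTensorField E M j) (r + 1)
      (((-Complex.I * hbar) ^ (r + 1))⁻¹ • symbol hP), ?_⟩
    rw [map_add, Submodule.coe_add, hΦ, quantization_lof]
    exact sub_add_cancel (G := SmoothFun E M →ₗ[ℂ] SmoothFun E M) _ _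

/-- The quantization rule as a linear equivalence. -/
def quantizationEquiv (hhbar : hbar ≠ 0) : SymTensors E M ≃ₗ[ℂ] DiffOp E M :=
  LinearEquiv.ofBijective (quantization hsmooth hbar)
    ⟨injective_quantization hsmooth hhbar, fun P ↦ by
      obtain ⟨r, hP⟩ := P.2
      obtain ⟨Φ, hΦ⟩ := exists_quantization_eq hsmooth hhbar hP
      exact ⟨Φ, Subtype.ext hΦ⟩⟩

end Quantization

end

end Quantization

end

/-! ### The quantization theorem -/

open Quantization in
theorem mainTheorem2
    {E : Type*} [NormedAddCommGroup E] [NormedSpace ℝ E] [FiniteDimensional ℝ E]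
    {M : Type*} [TopologicalSpace M] [T2Space M] [ChartedSpace E M] [IsManifold 𝓘(ℝ, E) ∞ M]
    (nabla : CovariantDerivative 𝓘(ℝ, E) E (TangentSpace 𝓘(ℝ, E) : M → Type _))
    (hsmooth : CovariantDerivative.ContMDiffCovariantDerivative nabla ∞)
    (htorsion : nabla.torsion = 0)
    (hbar : ℝ) (hhbar : hbar ≠ 0) :
    -- each differential operator of order `r` has exactly one symbol of order `r`
    (∀ (r : ℕ) (P : DiffOp E M), HasOrder r P.1 →
      ∃! σ : SymTensorField E M r, IsSymbol r P.1 σ) ∧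
    -- the quantization rule is a (linear) bijection
    ∃ Q : SymTensors E M ≃ₗ[ℂ] DiffOp E M,
      (∀ (r : ℕ) (Φ : SymTensorField E M r) (f : SmoothFun E M),
        ((Q (DirectSum.lof ℂ ℕ (fun j ↦ SymTensorField E M j) r Φ)).1 f : M → ℂ) =
          quantized nabla hbar Φ f) ∧
      -- recursive determination of the tensor that corresponds to an operator of order `r`
      ∀ (r : ℕ) (P : DiffOp E M), HasOrder r P.1 → ∀ Φ : SymTensors E M, Q Φ = P →
        (∀ j, r < j → Φ j = 0) ∧
        IsSymbol r P.1 ((-Complex.I * hbar) ^ r • Φ r) ∧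
        (∀ k, 1 ≤ k → k ≤ r →
          IsSymbol (r - k)
            (P.1 - ∑ j ∈ Finset.Ioc (r - k) r,
              (Q (DirectSum.lof ℂ ℕ (fun j ↦ SymTensorField E M j) j (Φ j))).1)
            ((-Complex.I * hbar) ^ (r - k) • Φ (r - k))) ∧
        P = ∑ j ∈ Finset.range (r + 1),
          Q (DirectSum.lof ℂ ℕ (fun j ↦ SymTensorField E M j) j (Φ j)) := by
  refine ⟨fun r P hP ↦ ⟨symbol hP, isSymbol_symbol hP, fun σ hσ ↦ hσ.unique (isSymbol_symbol hP)⟩,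
    quantizationEquiv hsmooth hhbar, fun r Φ f ↦ ?_, fun r P hP Φ hΦ ↦ ?_⟩
  · change ((quantization hsmooth hbar _).1 f : M → ℂ) = _
    rw [quantization_lof, quantizedHom_apply]
  · change quantization hsmooth hbar Φ = P at hΦ
    subst hΦ
    have hz := eq_zero_of_hasOrder hsmooth hhbar hP
    refine ⟨hz, isSymbol_quantization hsmooth hbar hz, fun k _ hk ↦ ?_,
      quantization_eq_sum hsmooth hbar hz⟩
    change IsSymbol (r - k) (_ - ∑ j ∈ Finset.Ioc (r - k) r, (quantization hsmooth hbar _).1) _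
    rw [quantization_eq_sum hsmooth hbar hz, AddSubmonoidClass.coe_finsetSum]
    simp only [quantization_lof]
    -- Removing the degrees in `(r - k, r]` from the full sum leaves exactly the partial sum up to
    -- degree `r - k`, whose symbol is known.
    convert isSymbol_sum_quantizedHom hsmooth hbar Φ (r - k) using 1
    refine (sub_eq_iff_eq_add (G := SmoothFun E M →ₗ[ℂ] SmoothFun E M)).2 ?_
    rw [Finset.range_eq_Ico, Finset.range_eq_Ico,
      ← Finset.sum_Ico_consecutive _ (Nat.zero_le _) (Nat.succ_le_succ (Nat.sub_le r k))]
    rw [show Finset.Ico (r - k).succ r.succ = Finset.Ioc (r - k) r by ext; simp]
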